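/- Let $m\ge 1$ and consider $m$ buck converters in parallel with inductances $L_k>0$, source voltages $E_k\neq 0$ and a common output capacitor $C>0$ feeding a resistive load $R>0$. The state is $x=(\varphi,Q)\in\mathbb R^m\times\mathbb R$ (fluxes and charge), the input is the vector of duty cycles $d\in\mathbb R^m$, and $$\dot\varphi_k=-\frac{Q}{C}+E_kd_k\quad(1\le k\le m),\qquad \dot Q=\sum_{k=1}^m\frac{\varphi_k}{L_k}-\frac{Q}{RC}.$$ Let $Q_r>0$ and $J:\mathbb R^{m+1}\to\mathbb R$. **Problem 1.** A (dynamic) state feedback with internal state $\xi$ solves Problem 1 for the load $R$ if the closed loop, with state $(x,\xi)$, has a unique equilibrium $(x^\star,\xi^\star)$, this equilibrium is globally asymptotically stable, and $x^\star$ is the unique minimizer of $J(\varphi,Q)$ subject to $Q=Q_r$ and $(\dot\varphi,\dot Q)=0$ (i.e. over the steady states of the plant, under some constant input, with $Q=Q_r$). Here global asymptotic stability means: every initial state has a solution on $[0,\infty)$ and no solution escapes in finite time, the equilibrium is Lyapunov stable, and every solution converges to it. **Coordinates.** Put $1/L_{\mathrm{eq},k}=\sum_{j\le k}1/L_j$.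 Let $\Gamma^\top\in\mathbb R^{(m-1)\times m}$ be $\Gamma^\top=G-[\,0\ \ I_{m-1}]$, where the $k$-th row of $G$ is $L_{\mathrm{eq},k}[1/L_1,\dots,1/L_k,0,\dots,0]$, and let $M\in\mathbb R^{m\times m}$ be the (invertible) matrix with the rows of $\Gamma^\top$ on top of the row $L_{\mathrm{eq},m}[1/L_1,\dots,1/L_m]$. Set $\mathcal C=\Gamma^\top\varphi\in\mathbb R^{m-1}$, $\varphi_T=L_{\mathrm{eq},m}\sum_k\varphi_k/L_k$, so that $M\varphi=(\mathcal C,\varphi_T)$, and $$J_z(\mathcal C,\varphi_T)=J\big(M^{-1}(\mathcal C,\varphi_T),\,Q_r\big).$$ **Assumption 1.** $J_z$ is continuously differentiable and, for every $\varphi_T>0$, the map $J_z(\cdot,\varphi_T)$ is strictly convex and admits a minimum. For $R>0$ put $\varphi_T^\star=L_{\mathrm{eq},m}Q_r/(RC)$, $\mathcal C^\star=\operatorname{argmin}_{\mathcal C}J_z(\mathcal C,\varphi_T^\star)$, and $$h(\tilde{\mathcal C},\tilde\varphi_T)=\nabla_{\mathcal C}J_z(\tilde{\mathcal C}+\mathcal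 C^\star,\tilde\varphi_T+\varphi_T^\star)-\nabla_{\mathcal C}J_z(\tilde{\mathcal C}+\mathcal C^\star,\varphi_T^\star),\qquad W(\tilde{\mathcal C})=J_z(\tilde{\mathcal C}+\mathcal C^\star,\varphi_T^\star)-J_z(\mathcal C^\star,\varphi_T^\star).$$ - **F1)** There are two strictly increasing functions $G_1,G_2$ on $[0,\infty)$, null and (right-)differentiable at the origin, such that $\|h(\tilde{\mathcal C},\tilde\varphi_T)\|\le G_1(|\tilde\varphi_T|)+G_2(|\tilde\varphi_T|)\,\|\tilde{\mathcal C}\|$ for all $\tilde{\mathcal C}\in\mathbb R^{m-1}$, $\tilde\varphi_T\in\mathbb R$. - **F2)** There are constants $c,k>0$ such that $\|\tilde{\mathcal C}\|>c$ implies $\|\nabla W(\tilde{\mathcal C})\|\,\|\tilde{\mathcal C}\|\le k\,W(\tilde{\mathcal C})$. **Controller.** Let $\tilde E\in\mathbb R^{m-1}$ and $E_{\mathrm{eq}}$ be positive parameters, $K_\lambda\in\mathbb R^{(m-1)\times(m-1)}$, $k_d,k_i\in\mathbb R$. The load-independent controller is $$\dot\xi=k_i\frac{Q-Q_r}{C},\qquad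 \mu=-\frac1{E_{\mathrm{eq}}}\Big(k_d\frac{\varphi_T}{L_{\mathrm{eq},m}}+k_d\,\xi+L_{\mathrm{eq},m}k_i\frac{Q-Q_r}{C}\Big),$$ $$\lambda=-\operatorname{diag}(\tilde E)^{-1}K_\lambda\nabla_{\mathcal C}J_z(\mathcal C,\varphi_T),\qquad d=U\begin{bmatrix}\lambda\\ \mu\end{bmatrix},\quad U=\operatorname{diag}(E)^{-1}M^{-1}\operatorname{diag}(\tilde E,E_{\mathrm{eq}}).$$ **Theorem 2.** Let $K_\lambda=K_\lambda^\top\succ0$, $k_d>0$, $k_i>0$, and let Assumption 1 hold. Then this controller, which does not depend on $R$, solves Problem 1 for every load $R>0$ for which F1) and F2) hold. -/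

import Mathlib

open Set Filter Topology
open scoped Matrix

noncomputable section

namespace Buck

/-! ### Ordinary differential equations and global asymptotic stability -/

/-- `x` solves `ẋ = f x` on the time interval `I` (one-sided derivatives at end points). -/
def IsSolutionOn {V : Type*} [NormedAddCommGroup V] [NormedSpace ℝ V]
    (f : V → V) (I : Set ℝ) (x : ℝ → V) : Prop :=
  ∀ t ∈ I, HasDerivWithinAt x (f (x t)) I t

/-- Forward completeness: each initial state admits a solution on `[0, ∞)`, and there is no
finite escape, i.e. each solution on some `[0, T)` extends to a solution on `[0, ∞)`.
(The vector field need not be Lipschitz, so solutions need not be unique.) -/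
def ForwardComplete {V : Type*} [NormedAddCommGroup V] [NormedSpace ℝ V]
    (f : V → V) : Prop :=
  (∀ x₀ : V, ∃ x : ℝ → V, x 0 = x₀ ∧ IsSolutionOn f (Ici 0) x) ∧
  (∀ (T : ℝ) (x : ℝ → V), 0 < T → IsSolutionOn f (Ico 0 T) x →
    ∃ y : ℝ → V, IsSolutionOn f (Ici 0) y ∧ EqOn x y (Ico 0 T))

/-- `p` is a globally asymptotically stable equilibrium of `ẋ = f x`: it is an equilibrium, the
system is forward complete, `p` is Lyapunov stable, and every solution converges to `p`. -/
structure IsGAS {V : Type*} [NormedAddCommGroup V] [NormedSpace ℝ V]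
    (f : V → V) (p : V) : Prop where
  equilibrium : f p = 0
  complete : ForwardComplete f
  stable : ∀ ε > 0, ∃ δ > 0, ∀ x : ℝ → V, IsSolutionOn f (Ici 0) x →
    dist (x 0) p < δ → ∀ t ≥ 0, dist (x t) p < ε
  attractive : ∀ x : ℝ → V, IsSolutionOn f (Ici 0) x → Tendsto x atTop (𝓝 p)

/-! ### The plant: `m = n + 1` parallel buck converters -/

/-- The state `x = (φ, Q)`: inductor fluxes and capacitor charge. -/
abbrev State (n : ℕ) : Type := EuclideanSpace ℝ (Fin (n + 1)) × ℝ

/-- The circuit parameters: inductances, source voltages, capacitance (not the load). -/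
structure Circuit (n : ℕ) where
  L : Fin (n + 1) → ℝ
  E : Fin (n + 1) → ℝ
  C : ℝ

variable {n : ℕ}

/-- The model `φ̇ₖ = -Q/C + Eₖ dₖ`, `Q̇ = ∑ₖ φₖ/Lₖ - Q/(RC)` for load `R` and duty cycles `d`. -/
def Circuit.plant (P : Circuit n) (R : ℝ) (x : State n) (d : Fin (n + 1) → ℝ) : State n :=
  (WithLp.toLp 2 (fun k => -(x.2 / P.C) + P.E k * d k),
    (∑ k, x.1 k / P.L k) - x.2 / (R * P.C))

/-- A (possibly dynamic) state feedback `ξ̇ = update x ξ`, `d = output x ξ`. -/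
structure Feedback (n : ℕ) (Ξ : Type*) where
  update : State n → Ξ → Ξ
  output : State n → Ξ → (Fin (n + 1) → ℝ)

/-- The closed loop of plant and feedback, on the extended state `(x, ξ)`. -/
def Circuit.closedLoop (P : Circuit n) (R : ℝ) {Ξ : Type*} (κ : Feedback n Ξ)
    (s : State n × Ξ) : State n × Ξ :=
  (P.plant R s.1 (κ.output s.1 s.2), κ.update s.1 s.2)

/-- The constraint set of the optimization: `Q = Q_r`, and `x` is a steady state of the plant
(for some constant input). -/
def Circuit.admissible (P : Circuit n) (R Qr : ℝ) : Set (State n) :=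
  {x | x.2 = Qr ∧ ∃ d : Fin (n + 1) → ℝ, P.plant R x d = 0}

/-- The control problem for load `R`: the closed loop has a unique equilibrium `(x⋆, ξ⋆)`, it is
GAS, and `x⋆` is the (unique) minimizer of `J` among the steady states with `Q = Q_r`. -/
def SolvesProblem (P : Circuit n) (R Qr : ℝ) (J : State n → ℝ)
    {Ξ : Type*} [NormedAddCommGroup Ξ] [NormedSpace ℝ Ξ] (κ : Feedback n Ξ) : Prop :=
  ∃ (x : State n) (ξ : Ξ),
    (x ∈ P.admissible R Qr ∧ ∀ y ∈ P.admissible R Qr, y ≠ x → J x < J y) ∧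
    (∀ s : State n × Ξ, P.closedLoop R κ s = 0 ↔ s = (x, ξ)) ∧
    IsGAS (P.closedLoop R κ) (x, ξ)

/-! ### Change of coordinates -/

/-- Equivalent inductance of the coils with index at most `k`, in parallel. -/
def Circuit.Leq (P : Circuit n) (k : Fin (n + 1)) : ℝ :=
  (∑ j ∈ Finset.Iic k, 1 / P.L j)⁻¹

/-- Equivalent inductance of all the coils in parallel. -/
def Circuit.LeqTotal (P : Circuit n) : ℝ := P.Leq (Fin.last n)

/-- The matrix `G`, with rows `L_{eq,k} [1/L₁ ⋯ 1/Lₖ 0 ⋯ 0]`. -/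
def Circuit.G (P : Circuit n) : Matrix (Fin n) (Fin (n + 1)) ℝ :=
  Matrix.of fun k j => if j ≤ k.castSucc then P.Leq k.castSucc / P.L j else 0

/-- `Γᵀ = G - [0 I]`. -/
def Circuit.GammaT (P : Circuit n) : Matrix (Fin n) (Fin (n + 1)) ℝ :=
  P.G - Matrix.of fun k j => if j = k.succ then 1 else 0

/-- The row `1ᵀ diag(L)⁻¹ L_{eq,m}`. -/
def Circuit.totalRow (P : Circuit n) : Fin (n + 1) → ℝ := fun j => P.LeqTotal / P.L j

/-- The square matrix with the rows of `Γᵀ` on top of `1ᵀ diag(L)⁻¹ L_{eq,m}`; it maps `φ` to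
`(𝒞, φ_T)`. -/
def Circuit.M (P : Circuit n) : Matrix (Fin (n + 1)) (Fin (n + 1)) ℝ :=
  Matrix.of (Fin.snoc (α := fun _ => Fin (n + 1) → ℝ) (fun k => P.GammaT k) P.totalRow)

/-- The flux distribution `𝒞 = Γᵀ φ`. -/
def Circuit.fluxDist (P : Circuit n) (x : State n) : EuclideanSpace ℝ (Fin n) :=
  WithLp.toLp 2 (P.GammaT *ᵥ WithLp.ofLp x.1)

/-- The total flux `φ_T = L_{eq,m} ∑ₖ φₖ / Lₖ`. -/
def Circuit.phiT (P : Circuit n) (x : State n) : ℝ := P.LeqTotal * ∑ k, x.1 k / P.L k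

/-- The column vector `[v; a]`. -/
def stack (v : Fin n → ℝ) (a : ℝ) : Fin (n + 1) → ℝ :=
  Fin.snoc (α := fun _ => ℝ) v a

/-- The inverse change of coordinates `x = Φ (𝒞, φ_T, Q)`. -/
def Circuit.Phi (P : Circuit n) (c : EuclideanSpace ℝ (Fin n)) (φT Q : ℝ) : State n :=
  (WithLp.toLp 2 (P.M⁻¹ *ᵥ stack (WithLp.ofLp c) φT), Q)

/-- The input matrix `U = diag(E)⁻¹ M⁻¹ diag(Ẽ, E_eq)`. -/
def Circuit.U (P : Circuit n) (Et : Fin n → ℝ) (Eeq : ℝ) :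
    Matrix (Fin (n + 1)) (Fin (n + 1)) ℝ :=
  (Matrix.diagonal P.E)⁻¹ * P.M⁻¹ * Matrix.diagonal (stack Et Eeq)

/-! ### Cost function in the new coordinates and its assumptions -/

/-- `J_z(𝒞, φ_T) = J(Φ (𝒞, φ_T, Q_r))`. -/
def Circuit.Jz (P : Circuit n) (Qr : ℝ) (J : State n → ℝ)
    (c : EuclideanSpace ℝ (Fin n)) (φT : ℝ) : ℝ :=
  J (P.Phi c φT Qr)

/-- The partial gradient `∇_𝒞 J_z(𝒞, φ_T)`. -/
def Circuit.gradJz (P : Circuit n) (Qr : ℝ) (J : State n → ℝ)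
    (c : EuclideanSpace ℝ (Fin n)) (φT : ℝ) : EuclideanSpace ℝ (Fin n) :=
  gradient (fun c' => P.Jz Qr J c' φT) c

/-- `J_z` is continuously differentiable and, for each `φ_T > 0`, `J_z(·, φ_T)` is strictly convex
and has a minimum. -/
structure CostAssumption (P : Circuit n) (Qr : ℝ) (J : State n → ℝ) : Prop where
  smooth : ContDiff ℝ 1 (fun p : EuclideanSpace ℝ (Fin n) × ℝ => P.Jz Qr J p.1 p.2)
  convex : ∀ φT > 0, StrictConvexOn ℝ univ (fun c => P.Jz Qr J c φT)
  hasMin : ∀ φT > 0, ∃ c, ∀ c', P.Jz Qr J c φT ≤ P.Jz Qr J c' φT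

/-- `𝒞⋆(φ_T) = argmin J_z(·, φ_T)`. -/
def Circuit.Cstar (P : Circuit n) (Qr : ℝ) (J : State n → ℝ) (φT : ℝ) :
    EuclideanSpace ℝ (Fin n) :=
  Classical.epsilon fun c => ∀ c', P.Jz Qr J c φT ≤ P.Jz Qr J c' φT

/-- `φ_T⋆ = L_{eq,m} Q_r / (R C)`. -/
def Circuit.phiStar (P : Circuit n) (R Qr : ℝ) : ℝ := P.LeqTotal * Qr / (R * P.C)

/-- The coupling term `h(𝒞̃, φ̃_T)`. -/
def Circuit.h (P : Circuit n) (R Qr : ℝ) (J : State n → ℝ)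
    (c : EuclideanSpace ℝ (Fin n)) (φ : ℝ) : EuclideanSpace ℝ (Fin n) :=
  P.gradJz Qr J (c + P.Cstar Qr J (P.phiStar R Qr)) (φ + P.phiStar R Qr)
    - P.gradJz Qr J (c + P.Cstar Qr J (P.phiStar R Qr)) (P.phiStar R Qr)

/-- The function `W(𝒞̃)`. -/
def Circuit.W (P : Circuit n) (R Qr : ℝ) (J : State n → ℝ)
    (c : EuclideanSpace ℝ (Fin n)) : ℝ :=
  P.Jz Qr J (c + P.Cstar Qr J (P.phiStar R Qr)) (P.phiStar R Qr)
    - P.Jz Qr J (P.Cstar Qr J (P.phiStar R Qr)) (P.phiStar R Qr)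

/-- `G` is a strictly increasing function on `[0, ∞)`, null and differentiable at the origin. -/
structure IsGrowthFunction (G : ℝ → ℝ) : Prop where
  strictMono : StrictMonoOn G (Ici 0)
  zero : G 0 = 0
  diff : DifferentiableWithinAt ℝ G (Ici 0) 0

/-- Linear growth of the coupling term. -/
def GrowthF1 (P : Circuit n) (R Qr : ℝ) (J : State n → ℝ) : Prop :=
  ∃ G₁ G₂ : ℝ → ℝ, IsGrowthFunction G₁ ∧ IsGrowthFunction G₂ ∧
    ∀ (c : EuclideanSpace ℝ (Fin n)) (φ : ℝ),
      ‖P.h R Qr J c φ‖ ≤ G₁ |φ| + G₂ |φ| * ‖c‖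

/-- `‖∇W‖ ‖𝒞̃‖ ≤ k W` for large `𝒞̃`. -/
def GrowthF2 (P : Circuit n) (R Qr : ℝ) (J : State n → ℝ) : Prop :=
  ∃ c₀ > 0, ∃ k > 0, ∀ c : EuclideanSpace ℝ (Fin n), c₀ < ‖c‖ →
    ‖gradient (P.W R Qr J) c‖ * ‖c‖ ≤ k * P.W R Qr J c

/-! ### The load-independent controller -/

/-- The input `μ` of the equivalent buck. -/
def Circuit.mu (P : Circuit n) (Qr Eeq kd ki : ℝ) (x : State n) (ξ : ℝ) : ℝ :=
  -(1 / Eeq) * (kd * (P.phiT x / P.LeqTotal) + kd * ξ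
    + P.LeqTotal * ki * ((x.2 - Qr) / P.C))

/-- The input `λ = -diag(Ẽ)⁻¹ K ∇_𝒞 J_z(𝒞, φ_T)`. -/
def Circuit.lam (P : Circuit n) (Qr : ℝ) (J : State n → ℝ) (Et : Fin n → ℝ)
    (K : Matrix (Fin n) (Fin n) ℝ) (x : State n) : Fin n → ℝ :=
  -((Matrix.diagonal Et)⁻¹ *ᵥ (K *ᵥ WithLp.ofLp (P.gradJz Qr J (P.fluxDist x) (P.phiT x))))

/-- The controller: `ξ̇ = kᵢ (Q - Q_r)/C`, `d = U [λ; μ]`. It does not depend on the load. -/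
def Circuit.controller (P : Circuit n) (Qr : ℝ) (J : State n → ℝ) (Et : Fin n → ℝ) (Eeq : ℝ)
    (K : Matrix (Fin n) (Fin n) ℝ) (kd ki : ℝ) : Feedback n ℝ where
  update x _ := ki * ((x.2 - Qr) / P.C)
  output x ξ := P.U Et Eeq *ᵥ stack (P.lam Qr J Et K x) (P.mu Qr Eeq kd ki x ξ)

end Buck

end

/-! The matrices `M` and `U` split the closed loop into a cascade. The rows of `Γᵀ` sum to zero and
the last row of `M` sums to one, so the common voltage `-Q/C` reaches only `φ_T`. Hence `𝒞' = -K ∇_𝒞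
J_z(𝒞, φ_T)`, while `(φ_T, Q, ξ)` obeys an autonomous affine system.

In error coordinates, with `σ = φ_T/L + ξ` and `v = Q/C`, the last term of `μ` cancels `ξ'` and this
system becomes `Lσ' = -v - k_d σ`, `Cv' = σ - ξ - v/R`, `ξ' = k_i v`. Its energy is dissipated in
`σ` and `v`, and a small cross term in `ξ v` makes the decay strict, so it is exponentially stable
for every load (`exists_exp_decay`).

The upper part is a gradient flow of the convex `W`, perturbed by `h`. F1 makes `h` at most a
multiple of `|φ̃_T| (1 + ‖𝒞̃‖)`, and F2 bounds `‖∇W‖ (1 + ‖𝒞̃‖)` by a multiple of `W + 1`. Thus `W'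
≤ -κ‖∇W‖² + b e^{-αt} (W + 1)` (`exists_dissipation`). The last coefficient is integrable, so `W`
stays bounded. Strict convexity turns this into bounds on `𝒞̃`, excluding finite escape and giving
stability. On a bounded set `W ≤ ⟨∇W, 𝒞̃⟩` bounds the dissipation below by `a W²`, which forces `W →
0`.

Since `J_z` is only `C¹`, the field is merely continuous: existence rests on Peano's theorem, and
every estimate holds for all solutions. Optimality is immediate, because the admissible states are
exactly those with `Q = Q_r` and `φ_T = φ_T⋆`. -/

namespace Buck

/-! ### Peano existence and forward completeness -/

section Peano

variable {V : Type*} [NormedAddCommGroup V] [NormedSpace ℝ V]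

/-- Serves twice: `v = 0` makes the Euler polygons equi-Lipschitz, and `v = f (x s₀)` identifies the
derivative of their limit. -/
theorem norm_euler_sub_le {f : V → V} {h ε : ℝ} (hh : 0 ≤ h) {y : ℕ → V} {v : V}
    (hy : ∀ j, y (j + 1) = y j + h • f (y j)) (i p : ℕ)
    (hv : ∀ q < p, ‖f (y (i + q)) - v‖ ≤ ε) :
    ‖y (i + p) - y i - (p * h) • v‖ ≤ p * h * ε := by
  induction p with
  | zero => simp
  | succ p ih =>
    have h1 := ih fun q hq => hv q (by omega)
    have h2 := hv p (by omega)
    have e : y (i + (p + 1)) - y i - (((p + 1 : ℕ) : ℝ) * h) • v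
        = (y (i + p) - y i - (p * h) • v) + h • (f (y (i + p)) - v) := by
      rw [← add_assoc, hy]; push_cast; module
    rw [e]
    calc _ ≤ _ := norm_add_le _ _
      _ ≤ p * h * ε + h * ε := by
        rw [norm_smul, Real.norm_of_nonneg hh]; gcongr
      _ = _ := by push_cast; ring

theorem norm_euler_sub_le_of_bounded {f : V → V} {h B : ℝ} (hh : 0 ≤ h) {y : ℕ → V}
    (hy : ∀ j, y (j + 1) = y j + h • f (y j)) (hB : ∀ x, ‖f x‖ ≤ B) (i j : ℕ) :
    ‖y i - y j‖ ≤ |(i : ℝ) * h - j * h| * B := by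
  wlog hij : j ≤ i generalizing i j
  · rw [norm_sub_rev, abs_sub_comm]; exact this j i (by omega)
  obtain ⟨p, rfl⟩ := Nat.exists_eq_add_of_le hij
  have := norm_euler_sub_le hh hy j p (v := 0) (ε := B) fun q _ => by simpa using hB _
  simp only [smul_zero, sub_zero] at this
  convert this using 2
  push_cast
  rw [← sub_mul, abs_of_nonneg] <;> ring_nf
  positivity

/-- Peano's theorem for bounded continuous fields, by Euler's method. -/
theorem exists_isSolutionOn_of_bounded [ProperSpace V] {f : V → V} (hf : Continuous f) {B : ℝ}
    (hB : ∀ x, ‖f x‖ ≤ B) (x₀ : V) : ∃ x : ℝ → V, x 0 = x₀ ∧ IsSolutionOn f (Ici 0) x := by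
  have hB0 : 0 ≤ B := (norm_nonneg _).trans (hB 0)
  set h : ℕ → ℝ := fun k => 1 / ((k : ℝ) + 1) with hdef
  have hpos : ∀ k, 0 < h k := fun k => by positivity
  set y : ℕ → ℕ → V := fun k j => (fun z => z + h k • f z)^[j] x₀ with ydef
  have hy0 : ∀ k, y k 0 = x₀ := fun k => rfl
  have hy : ∀ k j, y k (j + 1) = y k j + h k • f (y k j) := fun k j => by
    simp only [ydef, Function.iterate_succ_apply']
  set X : ℕ → ℝ → V := fun k t => y k ⌊t / h k⌋₊ with Xdef
  have hfl : ∀ k, ∀ t ≥ 0, (⌊t / h k⌋₊ : ℝ) * h k ≤ t ∧ t < ⌊t / h k⌋₊ * h k + h k := by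
    intro k t ht
    have h1 := Nat.floor_le (a := t / h k) (div_nonneg ht (hpos k).le)
    have h2 := Nat.lt_floor_add_one (t / h k)
    rw [le_div_iff₀ (hpos k)] at h1
    rw [div_lt_iff₀ (hpos k)] at h2
    exact ⟨h1, by linarith⟩
  have hhlim : Tendsto h (hyperfilter ℕ : Filter ℕ) (𝓝 0) :=
    tendsto_one_div_add_atTop_nhds_zero_nat.mono_left Nat.hyperfilter_le_atTop
  -- Limits along one ultrafilter replace the subsequence of Arzelà–Ascoli: at each time the values
  -- stay in a compact ball, so they converge at all `t ≥ 0` at once.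
  have hlim : ∀ t, ∃ a, 0 ≤ t → Tendsto (fun k => X k t) (hyperfilter ℕ : Filter ℕ) (𝓝 a) := by
    intro t
    by_cases ht : 0 ≤ t
    swap
    · exact ⟨0, fun h => absurd h ht⟩
    have hmem : ∀ k, X k t ∈ Metric.closedBall x₀ (t * B) := by
      intro k
      rw [mem_closedBall_iff_norm, ← hy0 k]
      refine (norm_euler_sub_le_of_bounded (hpos k).le (hy k) hB _ _).trans ?_
      have := hfl k t ht
      gcongr
      rw [abs_le]
      constructor <;> push_cast <;> nlinarith [hpos k]
    obtain ⟨a, -, ha⟩ := (isCompact_closedBall x₀ (t * B)).ultrafilter_le_nhds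
      ((hyperfilter ℕ).map fun k => X k t)
      (by
        rw [Filter.le_principal_iff, Ultrafilter.mem_coe, Ultrafilter.mem_map]
        exact Filter.univ_mem' hmem)
    exact ⟨a, fun _ => ha⟩
  choose x hx using hlim
  have key : ∀ s₀ ≥ 0, ∀ ε > 0, ∃ η > 0, ∀ s t, 0 ≤ s → s ≤ t → |s - s₀| < η → |t - s₀| < η →
      ‖x t - x s - (t - s) • f (x s₀)‖ ≤ ε * (t - s) := by
    intro s₀ hs₀ ε hε
    obtain ⟨δ, hδ, hcont⟩ := Metric.continuous_iff.1 hf (x s₀) ε hε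
    -- At speed at most `B`, a time lag below this radius moves a polygon by at most `δ / 2`; the
    -- other half absorbs the mesh and the convergence error at `s₀`.
    refine ⟨δ / (2 * (B + 1)), by positivity, fun s t hs hst hs1 ht1 => ?_⟩
    set η := δ / (2 * (B + 1)) with hη
    have hηB : η * B ≤ δ / 2 := by
      rw [hη, div_mul_eq_mul_div, div_le_div_iff₀ (by positivity) (by norm_num)]; nlinarith
    have ht : 0 ≤ t := hs.trans hst
    set v := f (x s₀)
    have hsmall : Tendsto (fun k => (η + 2 * h k) * B + ‖X k s₀ - x s₀‖)
        (hyperfilter ℕ : Filter ℕ) (𝓝 ((η + 2 * 0) * B + 0)) := by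
      refine ((tendsto_const_nhds.add (hhlim.const_mul 2)).mul_const B).add ?_
      exact tendsto_iff_norm_sub_tendsto_zero.1 (hx s₀ hs₀)
    have hev := hsmall.eventually_lt_const (u := δ) (by linarith)
    have hbound : ∀ᶠ k in (hyperfilter ℕ : Filter ℕ),
        ‖X k t - X k s - (t - s) • v‖ ≤ (t - s + h k) * ε + h k * ‖v‖ := by
      filter_upwards [hev] with k hk
      have hp := hpos k
      obtain ⟨a1, a2⟩ := hfl k s hs
      obtain ⟨b1, b2⟩ := hfl k t ht
      obtain ⟨c1, c2⟩ := hfl k s₀ hs₀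
      have hle : ⌊s / h k⌋₊ ≤ ⌊t / h k⌋₊ := Nat.floor_le_floor (by gcongr)
      obtain ⟨p, hpe⟩ := Nat.exists_eq_add_of_le hle
      have hpe' : (⌊t / h k⌋₊ : ℝ) = ⌊s / h k⌋₊ + p := by exact_mod_cast hpe
      rw [hpe'] at b1 b2
      rw [abs_lt] at hs1 ht1
      have hmain := norm_euler_sub_le hp.le (hy k) ⌊s / h k⌋₊ p (v := v) (ε := ε) (by
        intro q hq
        rw [← dist_eq_norm]
        refine (hcont _ ?_).le
        rw [dist_eq_norm]
        refine lt_of_le_of_lt ?_ hk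
        have e : y k (⌊s / h k⌋₊ + q) - x s₀
          = (y k (⌊s / h k⌋₊ + q) - X k s₀) + (X k s₀ - x s₀) := by abel
        rw [e]
        refine (norm_add_le _ _).trans ?_
        gcongr
        refine (norm_euler_sub_le_of_bounded hp.le (hy k) hB _ _).trans ?_
        gcongr
        have hq' : (q : ℝ) * h k ≤ p * h k := by gcongr
        have hq0 : 0 ≤ (q : ℝ) * h k := by positivity
        push_cast
        rw [abs_le]
        constructor <;> nlinarith)
      rw [← hpe] at hmain
      have e : X k t - X k s - (t - s) • v
        = (y k ⌊t / h k⌋₊ - y k ⌊s / h k⌋₊ - (p * h k) • v) + (p * h k - (t - s)) • v := by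
        simp only [Xdef]; module
      rw [e]
      refine (norm_add_le _ _).trans ?_
      rw [norm_smul]
      gcongr
      · refine hmain.trans ?_
        gcongr
        nlinarith
      · rw [Real.norm_eq_abs, abs_le]
        constructor <;> nlinarith
    have l1 : Tendsto (fun k => ‖X k t - X k s - (t - s) • v‖) (hyperfilter ℕ : Filter ℕ)
        (𝓝 ‖x t - x s - (t - s) • v‖) :=
      (((hx t ht).sub (hx s hs)).sub_const _).norm
    have l2 : Tendsto (fun k => (t - s + h k) * ε + h k * ‖v‖) (hyperfilter ℕ : Filter ℕ)
        (𝓝 ((t - s + 0) * ε + 0 * ‖v‖)) :=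
      ((tendsto_const_nhds.add hhlim).mul_const ε).add (hhlim.mul_const _)
    have := le_of_tendsto_of_tendsto l1 l2 hbound
    linarith
  refine ⟨x, ?_, fun s₀ hs₀ => ?_⟩
  · refine tendsto_nhds_unique (hx 0 le_rfl) ?_
    simp [Xdef, hy0]
  · rw [hasDerivWithinAt_iff_isLittleO, Asymptotics.isLittleO_iff]
    intro ε hε
    obtain ⟨η, hη, hk⟩ := key s₀ hs₀ ε hε
    have hs₀' : (0 : ℝ) ≤ s₀ := hs₀
    filter_upwards [self_mem_nhdsWithin, mem_nhdsWithin_of_mem_nhds (Metric.ball_mem_nhds s₀ hη)]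
      with t ht htη
    have ht' : (0 : ℝ) ≤ t := ht
    rw [Metric.mem_ball, Real.dist_eq] at htη
    rcases le_total s₀ t with hst | hst
    · rw [Real.norm_of_nonneg (sub_nonneg.2 hst)]
      exact hk s₀ t hs₀ hst (by simpa using hη) htη
    · rw [Real.norm_of_nonpos (sub_nonpos.2 hst), neg_sub]
      have := hk t s₀ ht hst htη (by simpa using hη)
      have e : x t - x s₀ - (t - s₀) • f (x s₀) = -(x s₀ - x t - (s₀ - t) • f (x s₀)) := by module
      rw [e, norm_neg]
      exact this

theorem IsSolutionOn.mono {f : V → V} {I I' : Set ℝ} {x : ℝ → V} (hx : IsSolutionOn f I x)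
    (h : I' ⊆ I) : IsSolutionOn f I' x := fun t ht => (hx t (h ht)).mono h

theorem IsSolutionOn.continuousOn {f : V → V} {I : Set ℝ} {x : ℝ → V} (hx : IsSolutionOn f I x) :
    ContinuousOn x I := fun t ht => (hx t ht).continuousWithinAt

/-- Global existence for continuous fields whose solutions obey a bound depending on the
initial state only. -/
theorem exists_isSolutionOn_of_apriori [ProperSpace V] {f : V → V} (hf : Continuous f)
    {x₀ : V} {ρ : ℝ}
    (hρ : ∀ (T : ℝ) (x : ℝ → V), 0 < T → IsSolutionOn f (Ico 0 T) x → x 0 = x₀ →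
      ∀ t ∈ Ico 0 T, ‖x t‖ ≤ ρ) :
    ∃ x : ℝ → V, x 0 = x₀ ∧ IsSolutionOn f (Ici 0) x := by
  set r := max ρ ‖x₀‖ + 1 with hr
  -- The cutoff makes the field bounded and leaves it unchanged on the ball of radius `r`.
  set χ : V → ℝ := fun x => max 0 (min 1 (r + 1 - ‖x‖)) with hχ
  have hχc : Continuous χ := by fun_prop
  have hχ1 : ∀ x, ‖x‖ ≤ r → χ x = 1 := fun x hx => by
    simp only [hχ]; rw [min_eq_left (by linarith), max_eq_right zero_le_one]
  have hχ0 : ∀ x, r + 1 < ‖x‖ → χ x = 0 := fun x hx => by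
    simp only [hχ]; rw [max_eq_left]; exact (min_le_right _ _).trans (by linarith)
  have hgc : Continuous fun x => χ x • f x := hχc.smul hf
  obtain ⟨B, hB⟩ := (isCompact_closedBall (0 : V) (r + 1)).exists_bound_of_continuousOn
    hgc.continuousOn
  have hB' : ∀ x, ‖χ x • f x‖ ≤ max B 0 := by
    intro x
    by_cases hx : ‖x‖ ≤ r + 1
    · exact (hB x (by simpa using hx)).trans (le_max_left _ _)
    · rw [hχ0 x (not_le.1 hx)]; simp
  obtain ⟨x, hx0, hx⟩ := exists_isSolutionOn_of_bounded hgc hB' x₀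
  refine ⟨x, hx0, ?_⟩
  -- Before the first time `τ` at which the norm reaches `r`, the curve solves the original
  -- equation. The a priori bound then passes to the limit and gives `‖x τ‖ ≤ ρ < r`.
  have hbd : ∀ t ≥ 0, ‖x t‖ < r := by
    by_contra! hcon
    obtain ⟨t₁, ht₁, hrt₁⟩ := hcon
    have hcont : ContinuousOn (fun t => ‖x t‖) (Icc 0 t₁) :=
      (hx.continuousOn.mono Icc_subset_Ici_self).norm
    set S := {t ∈ Icc 0 t₁ | r ≤ ‖x t‖} with hS
    have hSc : IsClosed S := hcont.preimage_isClosed_of_isClosed isClosed_Icc isClosed_Ici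
    have hSne : S.Nonempty := ⟨t₁, ⟨ht₁, le_rfl⟩, hrt₁⟩
    have hSb : BddBelow S := ⟨0, fun t ht => ht.1.1⟩
    have hmem := hSc.csInf_mem hSne hSb
    set τ := sInf S with hτ
    have hτ0 : 0 < τ := by
      refine lt_of_le_of_ne hmem.1.1 fun h0 => ?_
      have := hmem.2
      rw [← h0, hx0, hr] at this
      linarith [le_max_right ρ ‖x₀‖]
    have hlt : ∀ t ∈ Ico 0 τ, ‖x t‖ < r := by
      intro t ht
      by_contra! hge
      exact absurd (csInf_le hSb (show t ∈ S from ⟨⟨ht.1, ht.2.le.trans hmem.1.2⟩, hge⟩))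
        (not_le.2 ht.2)
    have hsol : IsSolutionOn f (Ico 0 τ) x := by
      intro t ht
      have := (hx t ht.1).mono (Ico_subset_Ici_self : Ico 0 τ ⊆ Ici 0)
      simpa only [hχ1 _ (hlt t ht).le, one_smul] using this
    have hle : ∀ t ∈ Ico 0 τ, ‖x t‖ ≤ ρ := hρ τ x hτ0 hsol hx0
    have hct : Tendsto (fun t => ‖x t‖) (𝓝[Ico 0 τ] τ) (𝓝 ‖x τ‖) :=
      ((hx.continuousOn τ hmem.1.1).mono Ico_subset_Ici_self).norm
    have hne : (𝓝[Ico 0 τ] τ).NeBot := by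
      rw [← mem_closure_iff_nhdsWithin_neBot, closure_Ico hτ0.ne]
      exact right_mem_Icc.2 hτ0.le
    have := le_of_tendsto hct (eventually_mem_nhdsWithin.mono hle)
    have h2 := hmem.2
    rw [hr] at h2
    linarith [le_max_left ρ ‖x₀‖]
  intro t ht
  simpa only [hχ1 _ (hbd t ht).le, one_smul] using hx t ht

/-- A bounded solution has bounded velocity, hence is Lipschitz and Cauchy at `T`. -/
theorem IsSolutionOn.exists_tendsto [ProperSpace V] {f : V → V} (hf : Continuous f) {T ρ : ℝ}
    (hT : 0 < T) {x : ℝ → V} (hx : IsSolutionOn f (Ico 0 T) x) (hρ : ∀ t ∈ Ico 0 T, ‖x t‖ ≤ ρ) :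
    ∃ a, Tendsto x (𝓝[<] T) (𝓝 a) := by
  obtain ⟨B, hB⟩ := (isCompact_closedBall (0 : V) ρ).exists_bound_of_continuousOn hf.continuousOn
  have hlip : LipschitzOnWith (max B 0).toNNReal x (Ico 0 T) := by
    refine (convex_Ico 0 T).lipschitzOnWith_of_nnnorm_hasDerivWithin_le (fun t ht => hx t ht) ?_
    intro t ht
    rw [← NNReal.coe_le_coe, coe_nnnorm, Real.coe_toNNReal _ (le_max_right _ _)]
    exact (hB _ (by simpa using hρ t ht)).trans (le_max_left _ _)
  have hcau : Cauchy (map x (𝓝[<] T)) := by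
    rw [← nhdsWithin_Ico_eq_nhdsLT hT]
    have hne : (𝓝[Ico 0 T] T).NeBot := by
      rw [← mem_closure_iff_nhdsWithin_neBot, closure_Ico hT.ne]
      exact right_mem_Icc.2 hT.le
    exact (cauchy_nhds.mono nhdsWithin_le_nhds).map_of_le hlip.uniformContinuousOn
      inf_le_right
  exact CompleteSpace.complete hcau

theorem forwardComplete_of_apriori [ProperSpace V] {f : V → V} (hf : Continuous f)
    (hρ : ∀ x₀ : V, ∃ ρ, ∀ (T : ℝ) (x : ℝ → V), 0 < T → IsSolutionOn f (Ico 0 T) x → x 0 = x₀ →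
      ∀ t ∈ Ico 0 T, ‖x t‖ ≤ ρ) : ForwardComplete f := by
  have hex : ∀ x₀ : V, ∃ x : ℝ → V, x 0 = x₀ ∧ IsSolutionOn f (Ici 0) x := fun x₀ => by
    obtain ⟨ρ, h⟩ := hρ x₀
    exact exists_isSolutionOn_of_apriori hf h
  refine ⟨hex, fun T x hT hx => ?_⟩
  obtain ⟨ρ, h⟩ := hρ (x 0)
  obtain ⟨a, ha⟩ := hx.exists_tendsto hf hT (h T x hT hx rfl)
  obtain ⟨z, hz0, hz⟩ := hex a
  set y : ℝ → V := fun t => if t < T then x t else z (t - T) with hy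
  have hyx : ∀ t, t < T → y t = x t := fun t ht => if_pos ht
  have hyz : ∀ t, T ≤ t → y t = z (t - T) := fun t ht => if_neg (not_lt.2 ht)
  have hyT : y T = a := by rw [hyz T le_rfl, sub_self, hz0]
  have hderiv : ∀ t, 0 < t → t < T → HasDerivAt y (f (y t)) t := by
    intro t h0 h1
    have hxt := (hx t ⟨h0.le, h1⟩).hasDerivAt (Ico_mem_nhds h0 h1)
    rw [hyx t h1]
    exact hxt.congr_of_eventuallyEq (by filter_upwards [Iio_mem_nhds h1] with s hs using hyx s hs)
  have hright : ∀ t, T ≤ t → HasDerivWithinAt y (f (y t)) (Ici T) t := by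
    intro t ht
    have h1 : HasDerivWithinAt (fun s => z (s - T)) (f (z (t - T))) (Ici T) t := by
      have := (hz (t - T) (sub_nonneg.2 ht)).scomp t
        (((hasDerivAt_id t).sub_const T).hasDerivWithinAt (s := Ici T))
        (fun s hs => sub_nonneg.2 hs)
      simpa [Function.comp_def] using this
    rw [hyz t ht]
    exact h1.congr (fun s hs => hyz s hs) (hyz t ht)
  have htend : Tendsto y (𝓝[<] T) (𝓝 a) :=
    ha.congr' (eventually_mem_nhdsWithin.mono fun s hs => (hyx s hs).symm)
  -- At the junction the left derivative is the limit of the derivatives, by continuity of `f` along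
  -- the curve.
  have hleft : HasDerivWithinAt y (f (y T)) (Iic T) T := by
    refine hasDerivWithinAt_Iic_of_tendsto_deriv (s := Ioo 0 T) ?_ ?_ (Ioo_mem_nhdsLT hT) ?_
    · exact fun t ht => (hderiv t ht.1 ht.2).differentiableAt.differentiableWithinAt
    · rw [ContinuousWithinAt, hyT, nhdsWithin_Ioo_eq_nhdsLT hT]
      exact htend
    · rw [hyT]
      refine ((hf.tendsto a).comp htend).congr' ?_
      filter_upwards [Ioo_mem_nhdsLT hT] with s hs
      exact ((hderiv s hs.1 hs.2).deriv).symm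
  refine ⟨y, fun t ht => ?_, fun t ht => (hyx t ht.2).symm⟩
  rcases lt_trichotomy t T with h1 | h1 | h1
  · have h2 : HasDerivWithinAt y (f (x t)) (Ico 0 T) t :=
      (hx t ⟨ht, h1⟩).congr (fun s hs => hyx s hs.2) (hyx t h1)
    rw [hyx t h1]
    refine h2.mono_of_mem_nhdsWithin ?_
    rw [← Ici_inter_Iio]
    exact inter_mem_nhdsWithin _ (Iio_mem_nhds h1)
  · subst h1
    exact ((hleft.union (hright t le_rfl)).mono (by simp))
  · exact ((hright t h1.le).hasDerivAt (Ici_mem_nhds h1)).hasDerivWithinAt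

end Peano

/-! ### Scalar differential inequalities -/

theorem antitoneOn_of_hasDerivWithinAt {D : Set ℝ} (hD : Convex ℝ D) {u u' : ℝ → ℝ}
    (hu : ∀ t ∈ D, HasDerivWithinAt u (u' t) D t) (hle : ∀ t ∈ D, u' t ≤ 0) : AntitoneOn u D := by
  have hint : ∀ t ∈ interior D, HasDerivAt u (u' t) t := fun t ht =>
    (hu t (interior_subset ht)).hasDerivAt (mem_interior_iff_mem_nhds.1 ht)
  refine antitoneOn_of_deriv_nonpos hD (fun t ht => (hu t ht).continuousWithinAt)
    (fun t ht => (hint t ht).differentiableAt.differentiableWithinAt) fun t ht => ?_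
  rw [(hint t ht).deriv]
  exact hle t (interior_subset ht)

theorem hasDerivAt_exp_const_mul (a t : ℝ) :
    HasDerivAt (fun t => Real.exp (a * t)) (a * Real.exp (a * t)) t := by
  simpa [mul_comm] using ((hasDerivAt_id t).const_mul a).exp

theorem le_exp_of_deriv_le {T α : ℝ} {u u' : ℝ → ℝ}
    (hu : ∀ t ∈ Ico 0 T, HasDerivWithinAt u (u' t) (Ico 0 T) t)
    (hle : ∀ t ∈ Ico 0 T, u' t ≤ -α * u t) {t : ℝ} (ht : t ∈ Ico 0 T) :
    u t ≤ u 0 * Real.exp (-α * t) := by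
  have h := antitoneOn_of_hasDerivWithinAt (convex_Ico 0 T)
    (fun t ht => (hu t ht).mul (hasDerivAt_exp_const_mul α t).hasDerivWithinAt) (by
      intro s hs
      have := hle s hs
      have h2 := Real.exp_pos (α * s)
      nlinarith)
  have h0 := h ⟨le_rfl, ht.1.trans_lt ht.2⟩ ht ht.1
  simp only [Pi.mul_apply, mul_zero, Real.exp_zero, mul_one] at h0
  calc u t = (u t * Real.exp (α * t)) * Real.exp (-α * t) := by
        rw [mul_assoc, ← Real.exp_add]; simp
    _ ≤ _ := by gcongr

/-- Grönwall with an integrable coefficient: the integrating factor `exp((b/α) e^{-αt})` stays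
between `1` and `exp(b/α)`. -/
theorem le_of_deriv_le_exp_mul {T α b : ℝ} (hα : 0 < α) (hb : 0 ≤ b) {u u' : ℝ → ℝ}
    (hu0 : 0 ≤ u 0)
    (hu : ∀ t ∈ Ico 0 T, HasDerivWithinAt u (u' t) (Ico 0 T) t)
    (hle : ∀ t ∈ Ico 0 T, u' t ≤ b * Real.exp (-α * t) * u t) {t : ℝ} (ht : t ∈ Ico 0 T) :
    u t ≤ u 0 * Real.exp (b / α) := by
  have hE : ∀ t, HasDerivAt (fun t => Real.exp (b / α * Real.exp (-α * t)))
      (-(b * Real.exp (-α * t)) * Real.exp (b / α * Real.exp (-α * t))) t := by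
    intro t
    have := ((hasDerivAt_exp_const_mul (-α) t).const_mul (b / α)).exp
    convert this using 1
    field_simp
  have h := antitoneOn_of_hasDerivWithinAt (convex_Ico 0 T)
    (fun t ht => (hu t ht).mul (hE t).hasDerivWithinAt) (by
      intro s hs
      have := hle s hs
      have h2 := Real.exp_pos (b / α * Real.exp (-α * s))
      nlinarith)
  have h0 := h ⟨le_rfl, ht.1.trans_lt ht.2⟩ ht ht.1
  simp only [Pi.mul_apply, mul_zero, Real.exp_zero, mul_one] at h0
  have h1 : 1 ≤ Real.exp (b / α * Real.exp (-α * t)) := Real.one_le_exp (by positivity)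
  have h2 := Real.exp_pos (b / α)
  rcases le_or_gt (u t) 0 with h3 | h3
  · exact h3.trans (by positivity)
  · nlinarith

/-- Adding the remaining mass `(b/α) e^{-αt}` of the forcing to `w` gives a nonincreasing `u`. If
`w` stayed above `ε/2`, `u` would decrease linearly and become negative; once `w` and the mass are
both below `ε/2`, monotonicity keeps `w` below `ε`. -/
theorem tendsto_zero_of_deriv_le {a b α : ℝ} (ha : 0 < a) (hb : 0 ≤ b) (hα : 0 < α)
    {w w' : ℝ → ℝ} (hw0 : ∀ t ≥ 0, 0 ≤ w t)
    (hw : ∀ t ∈ Ici (0 : ℝ), HasDerivWithinAt w (w' t) (Ici 0) t)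
    (hle : ∀ t ≥ 0, w' t ≤ -a * w t ^ 2 + b * Real.exp (-α * t)) :
    Tendsto w atTop (𝓝 0) := by
  set u : ℝ → ℝ := fun t => w t + b / α * Real.exp (-α * t) with hu
  have hud : ∀ t ∈ Ici (0 : ℝ), HasDerivWithinAt u (w' t - b * Real.exp (-α * t)) (Ici 0) t := by
    intro t ht
    have := (hw t ht).add ((hasDerivAt_exp_const_mul (-α) t).const_mul (b / α)).hasDerivWithinAt
    refine this.congr_deriv ?_
    field_simp
    ring
  have hanti : AntitoneOn u (Ici 0) := antitoneOn_of_hasDerivWithinAt (convex_Ici 0) hud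
    fun t ht => by have := hle t ht; nlinarith [sq_nonneg (w t)]
  have hexp : Tendsto (fun t => b / α * Real.exp (-α * t)) atTop (𝓝 0) := by
    have : Tendsto (fun t => Real.exp (-α * t)) atTop (𝓝 0) := by
      refine (Real.tendsto_exp_neg_atTop_nhds_zero.comp (tendsto_id.const_mul_atTop hα)).congr ?_
      intro t
      simp
    simpa using this.const_mul (b / α)
  rw [Metric.tendsto_atTop]
  intro ε hε
  obtain ⟨T₀, hT₀⟩ := eventually_atTop.1
    ((hexp.eventually_lt_const (half_pos hε)).and (eventually_ge_atTop 0))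
  have hT0 : 0 ≤ T₀ := (hT₀ T₀ le_rfl).2
  have hsub : Ici T₀ ⊆ Ici (0 : ℝ) := Ici_subset_Ici.2 hT0
  obtain ⟨t₁, ht₁, hwt₁⟩ : ∃ t₁ ≥ T₀, w t₁ < ε / 2 := by
    by_contra! hcon
    set η := a * (ε / 2) ^ 2 with hη
    have hηp : 0 < η := by positivity
    have h := antitoneOn_of_hasDerivWithinAt (convex_Ici T₀) (u := fun t => u t + η * t)
      (fun t ht => ((hud t (hsub ht)).mono hsub).add
        ((hasDerivAt_id t).const_mul η).hasDerivWithinAt) (by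
        intro t ht
        have h1 := hle t (hsub ht)
        have h2 : η ≤ a * w t ^ 2 := by
          have := hcon t ht
          rw [hη]; gcongr
        linarith)
    have hu0 : ∀ t ∈ Ici (0 : ℝ), 0 ≤ u t := fun t ht => by
      have := hw0 t ht
      positivity
    have hu00 := hu0 T₀ hT0
    -- At this time the linear decrease would give `u t ≤ -1`.
    set t := T₀ + (u T₀ + 1) / η with htd
    have htT : T₀ ≤ t := by rw [htd]; linarith [show 0 ≤ (u T₀ + 1) / η by positivity]
    have h1 := h (self_mem_Ici) (show t ∈ Ici T₀ from htT) htT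
    have h2 := hu0 t (hsub htT)
    have h3 : η * t = η * T₀ + (u T₀ + 1) := by rw [htd]; field_simp
    simp only at h1
    linarith
  refine ⟨t₁, fun t ht => ?_⟩
  have h0 := hw0 t (hT0.trans (ht₁.le.trans ht))
  have h1 := hanti (hsub ht₁) (hsub (ht₁.le.trans ht)) ht
  have h2 := (hT₀ t₁ ht₁).1
  have h3 : 0 ≤ b / α * Real.exp (-α * t) := by positivity
  simp only [hu] at h1
  rw [Real.dist_eq, sub_zero, abs_of_nonneg h0]
  linarith

/-! ### The equivalent buck -/

/-- Exponential stability of the (error) dynamics of the equivalent buck with its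
proportional-integral controller. -/
theorem exists_exp_decay {L C R kd ki : ℝ} (hL : 0 < L) (hC : 0 < C) (hR : 0 < R) (hkd : 0 < kd)
    (hki : 0 < ki) :
    ∃ A > 0, ∃ α > 0, ∀ (T : ℝ) (σ v ξ : ℝ → ℝ),
      (∀ t ∈ Ico 0 T, HasDerivWithinAt σ ((-v t - kd * σ t) / L) (Ico 0 T) t) →
      (∀ t ∈ Ico 0 T, HasDerivWithinAt v ((σ t - ξ t - v t / R) / C) (Ico 0 T) t) →
      (∀ t ∈ Ico 0 T, HasDerivWithinAt ξ (ki * v t) (Ico 0 T) t) →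
      ∀ t ∈ Ico 0 T, σ t ^ 2 + v t ^ 2 + ξ t ^ 2
        ≤ A * (σ 0 ^ 2 + v 0 ^ 2 + ξ 0 ^ 2) * Real.exp (-α * t) := by
  -- The first two bounds let the dissipation in `σ` and `v` absorb the terms produced by the cross
  -- term; the last two keep the cross term below half of the quadratic energy in `v` and `ξ`.
  obtain ⟨ε, hε, e1, e2, e3, e4⟩ : ∃ ε > 0, ε ≤ kd / 2 ∧ ε * (ki * C + 1 / R ^ 2) ≤ 1 / (2 * R) ∧
      ε * C ≤ 1 / (2 * ki) ∧ ε ≤ 1 / 2 := by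
    refine ⟨min (min (kd / 2) (1 / (2 * R) / (ki * C + 1 / R ^ 2)))
      (min (1 / (2 * ki) / C) (1 / 2)), by positivity, ?_, ?_, ?_, ?_⟩
    · exact (min_le_left _ _).trans (min_le_left _ _)
    · rw [← le_div_iff₀ (by positivity)]
      exact (min_le_left _ _).trans (min_le_right _ _)
    · rw [← le_div_iff₀ (by positivity)]
      exact (min_le_right _ _).trans (min_le_left _ _)
    · exact (min_le_right _ _).trans (min_le_right _ _)
  obtain ⟨a₁, ha₁, l1, l2, l3⟩ : ∃ a₁ > 0, a₁ ≤ L / 2 ∧ a₁ ≤ C / 4 ∧ a₁ ≤ 1 / (4 * ki) :=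
    ⟨min (L / 2) (min (C / 4) (1 / (4 * ki))), by positivity, by simp, by simp, by simp⟩
  obtain ⟨a₂, ha₂, u1, u2, u3⟩ : ∃ a₂ > 0, L / 2 ≤ a₂ ∧ C ≤ a₂ ∧ 1 / ki ≤ a₂ :=
    ⟨max (L / 2) (max C (1 / ki)), by positivity, by simp, by simp, by simp⟩
  obtain ⟨a₃, ha₃, d1, d2, d3⟩ : ∃ a₃ > 0, a₃ ≤ kd / 2 ∧ a₃ ≤ 1 / (2 * R) ∧ a₃ ≤ ε / 2 :=
    ⟨min (kd / 2) (min (1 / (2 * R)) (ε / 2)), by positivity, by simp, by simp, by simp⟩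
  -- The energy alone has derivative `-kd σ² - v²/R`, blind to `ξ`. The derivative of `ε C ξ v`
  -- supplies the missing `-ε ξ²`.
  set V : ℝ → ℝ → ℝ → ℝ := fun s v x =>
    L / 2 * s ^ 2 + C / 2 * v ^ 2 + 1 / (2 * ki) * x ^ 2 + ε * C * (x * v) with hV
  have hcross : ∀ v x : ℝ, |ε * C * (x * v)| ≤ 1 / (4 * ki) * x ^ 2 + C / 4 * v ^ 2 := by
    intro v x
    have h1 : |x * v| ≤ (x ^ 2 + v ^ 2) / 2 := by
      rw [abs_le]; constructor <;> nlinarith [sq_nonneg (x + v), sq_nonneg (x - v)]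
    rw [abs_mul, abs_of_pos (by positivity : 0 < ε * C)]
    have h2 : ε * C * x ^ 2 ≤ 1 / (2 * ki) * x ^ 2 := by gcongr
    have h3 : ε * C * v ^ 2 ≤ 1 / 2 * C * v ^ 2 := by gcongr
    have h4 : 1 / (2 * ki) * x ^ 2 = 2 * (1 / (4 * ki) * x ^ 2) := by field_simp; ring
    have h5 : ε * C * |x * v| ≤ ε * C * ((x ^ 2 + v ^ 2) / 2) := by gcongr
    nlinarith
  have hki4 : 1 / (2 * ki) = 2 * (1 / (4 * ki)) := by field_simp; norm_num
  have hki2 : 1 / ki = 4 * (1 / (4 * ki)) := by field_simp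
  have hlow : ∀ s v x, a₁ * (s ^ 2 + v ^ 2 + x ^ 2) ≤ V s v x := by
    intro s v x
    have h := (abs_le.1 (hcross v x)).1
    have h1 : a₁ * s ^ 2 ≤ L / 2 * s ^ 2 := by gcongr
    have h2 : a₁ * v ^ 2 ≤ C / 4 * v ^ 2 := by gcongr
    have h3 : a₁ * x ^ 2 ≤ 1 / (4 * ki) * x ^ 2 := by gcongr
    simp only [hV]
    rw [hki4]
    nlinarith
  have hup : ∀ s v x, V s v x ≤ a₂ * (s ^ 2 + v ^ 2 + x ^ 2) := by
    intro s v x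
    have h := (abs_le.1 (hcross v x)).2
    have h1 : L / 2 * s ^ 2 ≤ a₂ * s ^ 2 := by gcongr
    have h2 : C * v ^ 2 ≤ a₂ * v ^ 2 := by gcongr
    have h3 : 1 / ki * x ^ 2 ≤ a₂ * x ^ 2 := by gcongr
    have h4 : 0 ≤ 1 / (4 * ki) * x ^ 2 := by positivity
    have h5 : 0 ≤ C * v ^ 2 := by positivity
    rw [hki2] at h3
    simp only [hV]
    rw [hki4]
    nlinarith
  refine ⟨a₂ / a₁, by positivity, a₃ / a₂, by positivity, fun T σ v ξ hσ hv hξ t ht => ?_⟩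
  have hdV : ∀ t ∈ Ico 0 T, HasDerivWithinAt (fun t => V (σ t) (v t) (ξ t))
      (-kd * σ t ^ 2 - v t ^ 2 / R
        + ε * (ki * C * v t ^ 2 + ξ t * σ t - ξ t ^ 2 - ξ t * v t / R)) (Ico 0 T) t := by
    intro t ht
    have := (((((hσ t ht).pow 2).const_mul (L / 2)).add (((hv t ht).pow 2).const_mul (C / 2))).add
      (((hξ t ht).pow 2).const_mul (1 / (2 * ki)))).add
      (((hξ t ht).mul (hv t ht)).const_mul (ε * C))
    refine this.congr_deriv ?_
    field_simp
    ring
  have hle : ∀ t ∈ Ico 0 T, -kd * σ t ^ 2 - v t ^ 2 / R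
        + ε * (ki * C * v t ^ 2 + ξ t * σ t - ξ t ^ 2 - ξ t * v t / R)
        ≤ -(a₃ / a₂) * V (σ t) (v t) (ξ t) := by
    intro t _
    generalize σ t = s
    generalize v t = w
    generalize ξ t = x
    -- The two Young inequalities each spend `ε x²/4`, leaving half of the `-ε x²`.
    have h1 : ε * (x * s) ≤ ε * (x ^ 2 / 4 + s ^ 2) := by
      gcongr; nlinarith [sq_nonneg (x / 2 - s)]
    have h2 : ε * (-(x * w / R)) ≤ ε * (x ^ 2 / 4 + w ^ 2 * (1 / R ^ 2)) := by
      gcongr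
      have : w ^ 2 * (1 / R ^ 2) = (w / R) ^ 2 := by field_simp
      rw [this, mul_div_assoc]; nlinarith [sq_nonneg (x / 2 + w / R)]
    have h3 : ε * s ^ 2 ≤ kd / 2 * s ^ 2 := by gcongr
    have h4 : ε * (ki * C + 1 / R ^ 2) * w ^ 2 ≤ 1 / (2 * R) * w ^ 2 := by gcongr
    have h5 : w ^ 2 / R = 2 * (1 / (2 * R) * w ^ 2) := by field_simp
    have k1 : a₃ * s ^ 2 ≤ kd / 2 * s ^ 2 := by gcongr
    have k2 : a₃ * w ^ 2 ≤ 1 / (2 * R) * w ^ 2 := by gcongr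
    have k3 : a₃ * x ^ 2 ≤ ε / 2 * x ^ 2 := by gcongr
    have h6 : a₃ / a₂ * V s w x ≤ a₃ * (s ^ 2 + w ^ 2 + x ^ 2) := by
      calc _ ≤ a₃ / a₂ * (a₂ * (s ^ 2 + w ^ 2 + x ^ 2)) := by gcongr; exact hup s w x
        _ = _ := by field_simp
    rw [h5]
    have e : -(a₃ / a₂) * V s w x = -(a₃ / a₂ * V s w x) := by ring
    rw [e]
    clear_value V
    generalize a₃ / a₂ * V s w x = p at *
    generalize 1 / (2 * R) * w ^ 2 = q at *
    generalize x * w / R = r at *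
    generalize 1 / R ^ 2 = r₂ at *
    linarith
  have h := le_exp_of_deriv_le hdV hle ht
  have h1 := hlow (σ t) (v t) (ξ t)
  have h2 := hup (σ 0) (v 0) (ξ 0)
  have h3 : a₁ * (σ t ^ 2 + v t ^ 2 + ξ t ^ 2)
      ≤ a₂ * (σ 0 ^ 2 + v 0 ^ 2 + ξ 0 ^ 2) * Real.exp (-(a₃ / a₂) * t) :=
    h1.trans (h.trans (by gcongr))
  rw [div_mul_eq_mul_div, div_mul_eq_mul_div, le_div_iff₀ ha₁]
  linarith

/-! ### The cascade of the equivalent buck and the flux distribution dynamics -/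

/-- Near `0` differentiability gives a linear bound; from `δ` to `r` monotonicity does, since `G s ≤
(G r / δ) s`. This is what passes the exponential decay of `φ` on to the perturbation. -/
theorem IsGrowthFunction.exists_le_mul {G : ℝ → ℝ} (hG : IsGrowthFunction G) (r : ℝ) :
    ∃ κ ≥ 0, ∀ s, 0 ≤ s → s ≤ r → G s ≤ κ * s := by
  obtain ⟨D, hD⟩ := hG.diff
  have h := hD.hasDerivWithinAt
  rw [hasDerivWithinAt_iff_isLittleO, Asymptotics.isLittleO_iff] at h
  have h1 := h one_pos
  rw [eventually_nhdsWithin_iff, Metric.eventually_nhds_iff] at h1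
  obtain ⟨δ, hδ, h1⟩ := h1
  simp only [hG.zero, sub_zero, one_mul, smul_eq_mul, Real.dist_eq, Real.norm_eq_abs] at h1
  have hr0 : 0 ≤ G (max r 0) := by
    have := hG.strictMono.monotoneOn self_mem_Ici (mem_Ici.2 (le_max_right r 0)) (le_max_right r 0)
    rwa [hG.zero] at this
  refine ⟨|D 1| + 1 + G (max r 0) / δ, by positivity, fun s hs hsr => ?_⟩
  have hG0 : 0 ≤ G (max r 0) / δ * s := by positivity
  rcases lt_or_ge s δ with hlt | hge
  · have h2 := h1 (by rwa [abs_of_nonneg hs]) hs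
    rw [abs_of_nonneg hs] at h2
    have h3 := (abs_le.1 h2).2
    have h4 : s * D 1 ≤ |D 1| * s := by nlinarith [le_abs_self (D 1)]
    nlinarith
  · have h2 : G s ≤ G (max r 0) :=
      hG.strictMono.monotoneOn hs (le_max_right r 0) (hsr.trans (le_max_left r 0))
    have h3 : G (max r 0) ≤ G (max r 0) / δ * s := by
      rw [div_mul_eq_mul_div, le_div_iff₀ hδ]; gcongr
    nlinarith [abs_nonneg (D 1)]

/-! ### Convexity estimates -/

variable {E : Type*} [NormedAddCommGroup E] [InnerProductSpace ℝ E]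

/-- The tangent to `W` at `c` lies below `W` at the origin; read along the segment from `c` to `0`.
-/
theorem le_inner_of_convexOn [CompleteSpace E] {W : E → ℝ} (hW : ConvexOn ℝ univ W) (h0 : W 0 = 0) {c g : E}
    (hg : HasGradientAt W g c) : W c ≤ inner ℝ g c := by
  have hline : HasDerivAt (fun t : ℝ => W (c - t • c)) (-(inner ℝ g c)) 0 := by
    have h1 : HasDerivAt (fun t : ℝ => c - t • c) (-c) 0 := by
      simpa using ((hasDerivAt_id (0 : ℝ)).smul_const c).const_sub c
    have h2 := (show HasGradientAt W g (c - (0 : ℝ) • c) by simpa using hg).hasFDerivAt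
    simpa [Function.comp_def] using h2.comp_hasDerivAt (0 : ℝ) h1
  have hslope := hline.tendsto_slope_zero_right
  refine neg_le_neg_iff.1 (le_of_tendsto hslope ?_)
  filter_upwards [Ioo_mem_nhdsGT (zero_lt_one' ℝ)] with t ht
  have hconv := hW.2
  have h := hconv (mem_univ c) (mem_univ 0) (a := 1 - t) (b := t) (by linarith [ht.2]) ht.1.le
    (by ring)
  simp only [h0, smul_eq_mul, mul_zero, add_zero, smul_zero] at h
  have e : c - t • c = (1 - t) • c := by module
  simp only [zero_add, zero_smul, sub_zero, smul_eq_mul]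
  rw [e, inv_mul_le_iff₀ ht.1]
  linarith

/-- `W` is positive on the sphere of radius `δ`, as a zero there would make it negative halfway to
the origin. By convexity it then grows at least linearly along rays. Fixed `δ` gives coercivity;
arbitrary `δ` shows that small `W` forces small `c`. -/
theorem exists_mul_norm_le_of_strictConvexOn [FiniteDimensional ℝ E] {W : E → ℝ}
    (hW : StrictConvexOn ℝ univ W) (hWc : Continuous W) (h0 : W 0 = 0) (hmin : ∀ c, 0 ≤ W c)
    {δ : ℝ} (hδ : 0 < δ) : ∃ m > 0, ∀ c, δ ≤ ‖c‖ → m * ‖c‖ ≤ W c := by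
  have hpos : ∀ c ∈ Metric.sphere (0 : E) δ, 0 < W c := by
    intro c hc
    have hc0 : c ≠ 0 := by
      rintro rfl
      simp [hδ.ne] at hc
    have hconv := hW.2
    have h := hconv (mem_univ c) (mem_univ 0) hc0 (a := 1 / 2) (b := 1 / 2) (by norm_num)
      (by norm_num) (by norm_num)
    have h1 := hmin ((1 / 2 : ℝ) • c + (1 / 2 : ℝ) • (0 : E))
    simp only [h0, smul_eq_mul] at h
    linarith
  obtain ⟨m, hm, hle⟩ := (isCompact_sphere (0 : E) δ).exists_forall_le' hWc.continuousOn hpos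
  refine ⟨m / δ, by positivity, fun c hc => ?_⟩
  have hcpos : 0 < ‖c‖ := hδ.trans_le hc
  have h1 := hle ((δ / ‖c‖) • c) (by
    rw [mem_sphere_zero_iff_norm, norm_smul, Real.norm_of_nonneg (by positivity)]
    field_simp)
  have hr : δ / ‖c‖ ≤ 1 := (div_le_one hcpos).2 hc
  have hconv := hW.convexOn.2
  have h2 := hconv (mem_univ c) (mem_univ 0) (a := δ / ‖c‖) (b := 1 - δ / ‖c‖)
    (by positivity) (by linarith) (by ring)
  simp only [h0, smul_eq_mul, mul_zero, add_zero, smul_zero] at h2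
  have h3 : m ≤ δ / ‖c‖ * W c := h1.trans h2
  rw [div_mul_eq_mul_div, le_div_iff₀ hcpos] at h3
  rw [div_mul_eq_mul_div, div_le_iff₀ hδ]
  linarith

/-- The cascade, in error coordinates `(𝒞, σ, v, ξ)`: the equivalent buck, driven by `σ`, the sum
of the total current and the controller state, and the gradient flow `𝒞' = -K F(𝒞, φ)` it
perturbs, where `F(𝒞, 0) = ∇W(𝒞)`. -/
structure Cascade (E : Type*) [NormedAddCommGroup E] [InnerProductSpace ℝ E]
    [CompleteSpace E] where
  L : ℝ
  C : ℝ
  R : ℝ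
  kd : ℝ
  ki : ℝ
  K : E →L[ℝ] E
  κ : ℝ
  F : E → ℝ → E
  W : E → ℝ
  L_pos : 0 < L
  C_pos : 0 < C
  R_pos : 0 < R
  kd_pos : 0 < kd
  ki_pos : 0 < ki
  κ_pos : 0 < κ
  K_ge : ∀ x, κ * ‖x‖ ^ 2 ≤ inner ℝ x (K x)
  F_cont : Continuous fun p : E × ℝ => F p.1 p.2
  W_grad : ∀ c, HasGradientAt W (F c 0) c
  W_zero : W 0 = 0
  W_nonneg : ∀ c, 0 ≤ W c
  W_convex : StrictConvexOn ℝ univ W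
  growth : ∃ G₁ G₂ : ℝ → ℝ, IsGrowthFunction G₁ ∧ IsGrowthFunction G₂ ∧
    ∀ c φ, ‖F c φ - F c 0‖ ≤ G₁ |φ| + G₂ |φ| * ‖c‖
  growthW : ∃ c₀ > 0, ∃ k > 0, ∀ c, c₀ < ‖c‖ → ‖F c 0‖ * ‖c‖ ≤ k * W c

namespace Cascade

/-- The vector field of the cascade. -/
noncomputable def field [CompleteSpace E] (S : Cascade E) (y : E × ℝ × ℝ × ℝ) : E × ℝ × ℝ × ℝ :=
  (-S.K (S.F y.1 (S.L * (y.2.1 - y.2.2.2))), (-y.2.2.1 - S.kd * y.2.1) / S.L,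
    (y.2.1 - y.2.2.2 - y.2.2.1 / S.R) / S.C, S.ki * y.2.2.1)

section Complete

variable [CompleteSpace E] (S : Cascade E)

theorem W_continuous : Continuous S.W :=
  continuous_iff_continuousAt.2 fun c => (S.W_grad c).continuousAt

theorem field_continuous : Continuous S.field := by
  have h := S.F_cont
  have h1 : Continuous fun y : E × ℝ × ℝ × ℝ => S.F y.1 (S.L * (y.2.1 - y.2.2.2)) :=
    h.comp (f := fun y : E × ℝ × ℝ × ℝ => (y.1, S.L * (y.2.1 - y.2.2.2))) (by fun_prop)
  unfold field
  fun_prop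

theorem W_le_inner (c : E) : S.W c ≤ inner ℝ (S.F c 0) c :=
  le_inner_of_convexOn S.W_convex.convexOn S.W_zero (S.W_grad c)

theorem F_zero : S.F 0 0 = 0 := by
  have hmin : IsLocalMin S.W 0 := Filter.Eventually.of_forall fun c => by
    rw [S.W_zero]; exact S.W_nonneg c
  have := hmin.hasFDerivAt_eq_zero (S.W_grad 0).hasFDerivAt
  simpa using this

theorem field_eq_zero_iff (y : E × ℝ × ℝ × ℝ) : S.field y = 0 ↔ y = 0 := by
  constructor
  · obtain ⟨c, σ, v, ξ⟩ := y
    intro h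
    simp only [field, Prod.mk_eq_zero, div_eq_zero_iff, S.L_pos.ne', S.C_pos.ne', or_false,
      mul_eq_zero, S.ki_pos.ne', false_or, neg_eq_zero] at h
    obtain ⟨h1, h2, h3, rfl⟩ := h
    have hσ : σ = 0 := by
      have : S.kd * σ = 0 := by linarith
      simpa [S.kd_pos.ne'] using this
    subst hσ
    have hξ : ξ = 0 := by simpa using h3
    subst hξ
    rw [sub_zero, mul_zero] at h1
    -- Coercivity of `K` kills the gradient; `W c ≤ ⟨∇W, c⟩ = 0` and strict convexity then leave
    -- only the origin.
    have hF : S.F c 0 = 0 := by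
      have := S.K_ge (S.F c 0)
      rw [h1, inner_zero_right] at this
      have h2 : ‖S.F c 0‖ ^ 2 ≤ 0 := by
        by_contra! hlt
        exact absurd this (not_le.2 (mul_pos S.κ_pos hlt))
      simpa using h2
    have hc : c = 0 := by
      by_contra hc
      have hconv := S.W_convex.2
      have h := hconv (mem_univ c) (mem_univ 0) hc (a := 1 / 2) (b := 1 / 2) (by norm_num)
        (by norm_num) (by norm_num)
      have h1 := S.W_nonneg ((1 / 2 : ℝ) • c + (1 / 2 : ℝ) • (0 : E))
      have h2 := S.W_le_inner c
      rw [hF, inner_zero_left] at h2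
      simp only [S.W_zero, smul_eq_mul] at h
      linarith
    simp [hc]
  · rintro rfl
    simp [field, S.F_zero]

theorem hasDerivWithinAt_fst {I : Set ℝ} {y : ℝ → E × ℝ × ℝ × ℝ} (hy : IsSolutionOn S.field I y)
    {t : ℝ} (ht : t ∈ I) :
    HasDerivWithinAt (fun t => (y t).1) (S.field (y t)).1 I t :=
  ((ContinuousLinearMap.fst ℝ E (ℝ × ℝ × ℝ)).hasFDerivAt).comp_hasDerivWithinAt t (hy t ht)

theorem hasDerivWithinAt_snd {I : Set ℝ} {y : ℝ → E × ℝ × ℝ × ℝ} (hy : IsSolutionOn S.field I y)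
    {t : ℝ} (ht : t ∈ I) :
    HasDerivWithinAt (fun t => (y t).2) (S.field (y t)).2 I t :=
  ((ContinuousLinearMap.snd ℝ E (ℝ × ℝ × ℝ)).hasFDerivAt).comp_hasDerivWithinAt t (hy t ht)

theorem exists_exp_decay_snd : ∃ A > 0, ∃ α > 0, ∀ (T : ℝ) (y : ℝ → E × ℝ × ℝ × ℝ),
    IsSolutionOn S.field (Ico 0 T) y → ∀ t ∈ Ico 0 T,
      ‖(y t).2‖ ≤ A * ‖y 0‖ * Real.exp (-α * t) := by
  obtain ⟨A, hA, α, hα, h⟩ := exists_exp_decay S.L_pos S.C_pos S.R_pos S.kd_pos S.ki_pos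
  -- The quadratic estimate loses a factor `3` to the sup norm of the product, and the square root
  -- halves the rate.
  refine ⟨Real.sqrt (3 * A), by positivity, α / 2, by positivity, fun T y hy t ht => ?_⟩
  have hs := fun t ht => S.hasDerivWithinAt_snd hy (t := t) ht
  have h2 := fun t ht =>
    ((ContinuousLinearMap.fst ℝ ℝ (ℝ × ℝ)).hasFDerivAt).comp_hasDerivWithinAt t (hs t ht)
  have h3 := fun t ht =>
    ((ContinuousLinearMap.fst ℝ ℝ ℝ ∘L ContinuousLinearMap.snd ℝ ℝ (ℝ × ℝ)).hasFDerivAt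
      ).comp_hasDerivWithinAt t (hs t ht)
  have h4 := fun t ht =>
    ((ContinuousLinearMap.snd ℝ ℝ ℝ ∘L ContinuousLinearMap.snd ℝ ℝ (ℝ × ℝ)).hasFDerivAt
      ).comp_hasDerivWithinAt t (hs t ht)
  have hm := h T (fun t => (y t).2.1) (fun t => (y t).2.2.1) (fun t => (y t).2.2.2) h2 h3 h4 t ht
  have hsq : ∀ x : ℝ, |x| ≤ ‖y 0‖ → x ^ 2 ≤ ‖y 0‖ ^ 2 := fun x hx => by
    rw [← sq_abs]; gcongr
  have b1 := hsq _ ((norm_fst_le (y 0).2).trans (norm_snd_le (y 0)))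
  have b2 := hsq _ ((norm_fst_le (y 0).2.2).trans ((norm_snd_le (y 0).2).trans (norm_snd_le (y 0))))
  have b3 := hsq _ ((norm_snd_le (y 0).2.2).trans ((norm_snd_le (y 0).2).trans (norm_snd_le (y 0))))
  have hexp : Real.exp (-(α / 2) * t) ^ 2 = Real.exp (-α * t) := by
    rw [← Real.exp_nat_mul]; congr 1; push_cast; ring
  have hrhs : (Real.sqrt (3 * A) * ‖y 0‖ * Real.exp (-(α / 2) * t)) ^ 2
      = A * (3 * ‖y 0‖ ^ 2) * Real.exp (-α * t) := by
    rw [mul_pow, mul_pow, Real.sq_sqrt (by positivity), hexp]; ring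
  have htot : (y t).2.1 ^ 2 + (y t).2.2.1 ^ 2 + (y t).2.2.2 ^ 2
      ≤ (Real.sqrt (3 * A) * ‖y 0‖ * Real.exp (-(α / 2) * t)) ^ 2 := by
    rw [hrhs]
    refine hm.trans ?_
    gcongr
    linarith
  have hN : 0 ≤ Real.sqrt (3 * A) * ‖y 0‖ * Real.exp (-(α / 2) * t) := by positivity
  rw [Prod.norm_def, Prod.norm_def]
  refine max_le ?_ (max_le ?_ ?_) <;> rw [Real.norm_eq_abs] <;> refine abs_le_of_sq_le_sq ?_ hN <;>
    nlinarith [sq_nonneg (y t).2.1, sq_nonneg (y t).2.2.1, sq_nonneg (y t).2.2.2]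

theorem exists_perturbation_le (r : ℝ) : ∃ κ₁ ≥ 0, ∀ c φ, |φ| ≤ r →
    ‖S.F c φ - S.F c 0‖ ≤ κ₁ * |φ| * (1 + ‖c‖) := by
  obtain ⟨G₁, G₂, h₁, h₂, hG⟩ := S.growth
  obtain ⟨k₁, hk₁, hle₁⟩ := h₁.exists_le_mul r
  obtain ⟨k₂, hk₂, hle₂⟩ := h₂.exists_le_mul r
  refine ⟨k₁ + k₂, by positivity, fun c φ hφ => (hG c φ).trans ?_⟩
  have e₁ := hle₁ _ (abs_nonneg φ) hφ
  have e₂ := mul_le_mul_of_nonneg_right (hle₂ _ (abs_nonneg φ) hφ) (norm_nonneg c)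
  have e₃ : 0 ≤ k₁ * |φ| * ‖c‖ := by positivity
  have e₄ : 0 ≤ k₂ * |φ| := by positivity
  linarith

end Complete

/-! ### Lyapunov analysis of the flux distribution -/

variable [FiniteDimensional ℝ E] (S : Cascade E)

/-- F2 acts outside the ball of radius `c₀`, compactness inside; the `+ 1` pays for the ball, where
F2 says nothing. -/
theorem exists_gradient_mul_le :
    ∃ κ₀ > 0, ∀ c, ‖S.F c 0‖ * (1 + ‖c‖) ≤ κ₀ * (S.W c + 1) := by
  obtain ⟨c₀, hc₀, k, hk, hle⟩ := S.growthW
  have hcont : Continuous fun c => S.F c 0 :=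
    S.F_cont.comp (f := fun c : E => (c, (0 : ℝ))) (by fun_prop)
  obtain ⟨B, hB⟩ := (isCompact_closedBall (0 : E) c₀).exists_bound_of_continuousOn
    hcont.continuousOn
  have hB0 : 0 ≤ B := (norm_nonneg _).trans (hB 0 (by simpa using hc₀.le))
  refine ⟨k / c₀ + k + B * (1 + c₀), by positivity, fun c => ?_⟩
  have hW := S.W_nonneg c
  rcases lt_or_ge c₀ ‖c‖ with h | h
  · have h1 := hle c h
    have h2 : ‖S.F c 0‖ ≤ k / c₀ * S.W c := by
      rw [div_mul_eq_mul_div, le_div_iff₀ hc₀]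
      refine le_trans ?_ h1
      gcongr
    have h3 : 0 ≤ k / c₀ + k + B * (1 + c₀) * (S.W c + 1) := by positivity
    nlinarith
  · have h1 := hB c (by simpa using h)
    have h2 : ‖S.F c 0‖ * (1 + ‖c‖) ≤ B * (1 + c₀) := by gcongr
    have h3 : 0 ≤ (k / c₀ + k) * (S.W c + 1) := by positivity
    have h4 : 0 ≤ B * (1 + c₀) * S.W c := by positivity
    linarith

/-- Dissipation inequality for `W` along solutions that start in a ball. -/
theorem exists_dissipation : ∃ α > 0, ∀ r, ∃ b ≥ 0, ∀ (I : Set ℝ) (y : ℝ → E × ℝ × ℝ × ℝ),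
    I = Ici 0 ∨ (∃ T, I = Ico 0 T) → IsSolutionOn S.field I y → ‖y 0‖ ≤ r →
    ∃ w' : ℝ → ℝ, ∀ t ∈ I, HasDerivWithinAt (fun t => S.W (y t).1) (w' t) I t ∧
      w' t ≤ -S.κ * ‖S.F (y t).1 0‖ ^ 2 + b * ‖y 0‖ * Real.exp (-α * t) * (S.W (y t).1 + 1) := by
  obtain ⟨A, hA, α, hα, hdecay⟩ := S.exists_exp_decay_snd
  obtain ⟨κ₀, hκ₀, hgrad⟩ := S.exists_gradient_mul_le
  refine ⟨α, hα, fun r => ?_⟩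
  obtain ⟨κ₁, hκ₁, hpert⟩ := S.exists_perturbation_le (S.L * (2 * (A * r)))
  have hL := S.L_pos
  -- The constant is uniform over the ball of initial states. The factor `‖y 0‖` is kept outside it,
  -- so that the perturbation vanishes with the initial error; Lyapunov stability needs this.
  refine ⟨‖S.K‖ * κ₁ * (S.L * (2 * A)) * κ₀, by positivity, fun I y hI hy hr => ?_⟩
  have hdec : ∀ t ∈ I, 0 ≤ t ∧ ‖(y t).2‖ ≤ A * ‖y 0‖ * Real.exp (-α * t) := by
    intro t ht
    rcases hI with rfl | ⟨T, rfl⟩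
    · exact ⟨ht, hdecay (t + 1) y (hy.mono Ico_subset_Ici_self) t ⟨ht, by linarith⟩⟩
    · exact ⟨ht.1, hdecay T y hy t ht⟩
  refine ⟨fun t => inner ℝ (S.F (y t).1 0) (S.field (y t)).1, fun t ht => ⟨?_, ?_⟩⟩
  · have := (S.W_grad (y t).1).hasFDerivAt.comp_hasDerivWithinAt t (S.hasDerivWithinAt_fst hy ht)
    simpa [Function.comp_def] using this
  · obtain ⟨ht0, hd⟩ := hdec t ht
    set φ := S.L * ((y t).2.1 - (y t).2.2.2) with hφ
    set c := (y t).1 with hc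
    set e := Real.exp (-α * t)
    have he0 : 0 < e := Real.exp_pos _
    have he1 : e ≤ 1 := Real.exp_le_one_iff.2 (by nlinarith)
    have hφ1 : |φ| ≤ S.L * (2 * A) * ‖y 0‖ * e := by
      rw [hφ, abs_mul, abs_of_pos hL]
      have h1 := (norm_fst_le (y t).2).trans hd
      have h2 := ((norm_snd_le (y t).2.2).trans (norm_snd_le (y t).2)).trans hd
      rw [Real.norm_eq_abs] at h1 h2
      have h3 := abs_sub (y t).2.1 (y t).2.2.2
      calc _ ≤ S.L * (A * ‖y 0‖ * e + A * ‖y 0‖ * e) := by gcongr; linarith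
        _ = _ := by ring
    have hφ2 : |φ| ≤ S.L * (2 * (A * r)) := by
      have hr0 : 0 ≤ r := (norm_nonneg _).trans hr
      refine hφ1.trans ?_
      calc _ ≤ S.L * (2 * A) * r * 1 := by gcongr
        _ = _ := by ring
    have hp := hpert c φ hφ2
    set g := S.F c 0
    -- The nominal gradient flow gives the dissipation; the rest is the coupling `h`, bounded by
    -- Cauchy–Schwarz.
    have hsplit : inner ℝ g (S.field (y t)).1
        = -inner ℝ g (S.K g) - inner ℝ g (S.K (S.F c φ - g)) := by
      simp only [field, ← hφ, ← hc, map_sub, inner_neg_right, inner_sub_right]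
      ring
    have hK := S.K_ge g
    have hcs : -inner ℝ g (S.K (S.F c φ - g))
        ≤ ‖S.K‖ * κ₁ * (S.L * (2 * A)) * κ₀ * ‖y 0‖ * e * (S.W c + 1) := by
      calc -inner ℝ g (S.K (S.F c φ - g)) ≤ |inner ℝ g (S.K (S.F c φ - g))| := neg_le_abs _
        _ ≤ ‖g‖ * ‖S.K (S.F c φ - g)‖ := abs_real_inner_le_norm _ _
        _ ≤ ‖g‖ * (‖S.K‖ * ‖S.F c φ - g‖) := by gcongr; exact S.K.le_opNorm _
        _ ≤ ‖g‖ * (‖S.K‖ * (κ₁ * (S.L * (2 * A) * ‖y 0‖ * e) * (1 + ‖c‖))) := by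
          gcongr
          exact hp.trans (by gcongr)
        _ = ‖S.K‖ * κ₁ * (S.L * (2 * A)) * ‖y 0‖ * e * (‖g‖ * (1 + ‖c‖)) := by ring
        _ ≤ ‖S.K‖ * κ₁ * (S.L * (2 * A)) * ‖y 0‖ * e * (κ₀ * (S.W c + 1)) := by
          exact mul_le_mul_of_nonneg_left (hgrad c) (by positivity)
        _ = _ := by ring
    change inner ℝ g (S.field (y t)).1 ≤ _
    rw [hsplit]
    linarith

theorem exists_W_le : ∀ r, ∃ B ≥ 0, ∀ (T : ℝ) (y : ℝ → E × ℝ × ℝ × ℝ),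
    IsSolutionOn S.field (Ico 0 T) y → ‖y 0‖ ≤ r → ∀ t ∈ Ico 0 T,
      S.W (y t).1 + 1 ≤ (S.W (y 0).1 + 1) * Real.exp (B * ‖y 0‖) := by
  obtain ⟨α, hα, h⟩ := S.exists_dissipation
  intro r
  obtain ⟨b, hb, h⟩ := h r
  refine ⟨b / α, by positivity, fun T y hy hr t ht => ?_⟩
  obtain ⟨w', hw⟩ := h _ y (Or.inr ⟨T, rfl⟩) hy hr
  have := le_of_deriv_le_exp_mul hα (b := b * ‖y 0‖) (by positivity)
    (u := fun t => S.W (y t).1 + 1) (by have := S.W_nonneg (y 0).1; positivity)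
    (fun t ht => (hw t ht).1.add_const 1) (fun t ht => (hw t ht).2.trans (by
      have := mul_nonneg S.κ_pos.le (sq_nonneg ‖S.F (y t).1 0‖)
      linarith)) ht
  convert this using 3
  ring

theorem exists_norm_le (r : ℝ) : ∃ ρ > 0, ∀ (T : ℝ) (y : ℝ → E × ℝ × ℝ × ℝ),
    IsSolutionOn S.field (Ico 0 T) y → ‖y 0‖ ≤ r → ∀ t ∈ Ico 0 T, ‖y t‖ ≤ ρ := by
  obtain ⟨A, hA, α, hα, hdecay⟩ := S.exists_exp_decay_snd
  obtain ⟨B, hB, hW⟩ := S.exists_W_le r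
  obtain ⟨m, hm, hco⟩ := exists_mul_norm_le_of_strictConvexOn S.W_convex S.W_continuous S.W_zero
    S.W_nonneg one_pos
  obtain ⟨M, hM⟩ := (isCompact_closedBall (0 : E) r).exists_bound_of_continuousOn
    S.W_continuous.continuousOn
  -- The `1` covers the unit ball, where the linear lower bound on `W` is not available.
  refine ⟨max (max 1 (((M + 1) * Real.exp (B * r)) / m)) (A * r), by positivity,
    fun T y hy hr t ht => ?_⟩
  rw [Prod.norm_def]
  refine max_le_max ?_ ?_
  · rcases le_or_gt 1 ‖(y t).1‖ with h | h
    · refine le_trans ?_ (le_max_right _ _)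
      rw [le_div_iff₀ hm]
      have h1 := hW T y hy hr t ht
      have h2 := hco _ h
      have h3 : S.W (y 0).1 ≤ M := (le_abs_self _).trans
        (hM _ (by simpa using (norm_fst_le (y 0)).trans hr))
      have h4 := S.W_nonneg (y 0).1
      have h5 : (S.W (y 0).1 + 1) * Real.exp (B * ‖y 0‖) ≤ (M + 1) * Real.exp (B * r) := by
        have : 0 ≤ M + 1 := by linarith
        gcongr
      linarith
    · exact h.le.trans (le_max_left _ _)
  · refine (hdecay T y hy t ht).trans ?_
    have he1 : Real.exp (-α * t) ≤ 1 := Real.exp_le_one_iff.2 (by nlinarith [ht.1])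
    have : 0 ≤ A * ‖y 0‖ := by positivity
    calc _ ≤ A * ‖y 0‖ * 1 := by gcongr
      _ ≤ A * r := by rw [mul_one]; gcongr

theorem isGAS : IsGAS S.field 0 where
  equilibrium := (S.field_eq_zero_iff 0).2 rfl
  complete := forwardComplete_of_apriori S.field_continuous fun y₀ => by
    obtain ⟨ρ, -, h⟩ := S.exists_norm_le ‖y₀‖
    exact ⟨ρ, fun T y _ hy h0 => h T y hy (by rw [h0])⟩
  stable := by
    intro ε hε
    obtain ⟨A, hA, α, hα, hdecay⟩ := S.exists_exp_decay_snd
    obtain ⟨B, hB, hW⟩ := S.exists_W_le 1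
    obtain ⟨m, hm, hco⟩ := exists_mul_norm_le_of_strictConvexOn S.W_convex S.W_continuous S.W_zero
      S.W_nonneg hε
    have hWc := S.W_continuous
    have hc1 : Continuous fun y : E × ℝ × ℝ × ℝ => (S.W y.1 + 1) * Real.exp (B * ‖y‖) := by
      fun_prop
    -- The bound on `W + 1` tends to `1` with the initial state. Once it is below `1 + m ε`, the
    -- lower bound `m ‖c‖ ≤ W` rules out `‖c‖ ≥ ε`.
    have hev : ∀ᶠ y : E × ℝ × ℝ × ℝ in 𝓝 0,
        (S.W y.1 + 1) * Real.exp (B * ‖y‖) < 1 + m * ε ∧ A * ‖y‖ < ε ∧ ‖y‖ < 1 := by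
      refine (hc1.tendsto' 0 1 (by simp [S.W_zero])).eventually_lt_const
        (by linarith [mul_pos hm hε]) |>.and (Eventually.and ?_ ?_)
      · exact ((continuous_const.mul continuous_norm).tendsto' 0 0 (by simp)).eventually_lt_const hε
      · exact (continuous_norm.tendsto' 0 0 (by simp)).eventually_lt_const one_pos
    obtain ⟨δ, hδ, h⟩ := Metric.eventually_nhds_iff.1 hev
    refine ⟨δ, hδ, fun y hy h0 t ht => ?_⟩
    obtain ⟨e1, e2, e3⟩ := h h0
    have hy' : IsSolutionOn S.field (Ico 0 (t + 1)) y := hy.mono Ico_subset_Ici_self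
    have htI : t ∈ Ico 0 (t + 1) := ⟨ht, by linarith⟩
    rw [dist_zero_right, Prod.norm_def]
    refine max_lt ?_ ?_
    · by_contra! hge
      have h1 := hco _ hge
      have h2 := hW _ y hy' e3.le t htI
      have h3 : m * ε ≤ m * ‖(y t).1‖ := by gcongr
      linarith
    · refine (hdecay _ y hy' t htI).trans_lt (lt_of_le_of_lt ?_ e2)
      have he1 : Real.exp (-α * t) ≤ 1 := Real.exp_le_one_iff.2 (by nlinarith)
      have : 0 ≤ A * ‖y 0‖ := by positivity
      exact mul_le_of_le_one_right this he1
  attractive := by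
    intro y hy
    obtain ⟨A, hA, β, hβ, hdecay⟩ := S.exists_exp_decay_snd
    obtain ⟨α, hα, h⟩ := S.exists_dissipation
    obtain ⟨b, hb, h⟩ := h ‖y 0‖
    obtain ⟨w', hw⟩ := h _ y (Or.inl rfl) hy le_rfl
    obtain ⟨ρ, hρ, hbd⟩ := S.exists_norm_le ‖y 0‖
    have hbd' : ∀ t ≥ 0, ‖y t‖ ≤ ρ := fun t ht =>
      hbd (t + 1) y (hy.mono Ico_subset_Ici_self) le_rfl t ⟨ht, by linarith⟩
    obtain ⟨M, hM⟩ := (isCompact_closedBall (0 : E) ρ).exists_bound_of_continuousOn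
      S.W_continuous.continuousOn
    have hM' : ∀ t ≥ 0, S.W (y t).1 ≤ M := fun t ht => (le_abs_self _).trans
      (hM _ (by simpa using (norm_fst_le (y t)).trans (hbd' t ht)))
    have hκ := S.κ_pos
    have hM0 : 0 ≤ M := (S.W_nonneg _).trans (hM' 0 le_rfl)
    have hWlim : Tendsto (fun t => S.W (y t).1) atTop (𝓝 0) := by
      -- On the ball of radius `ρ`, `W ≤ ρ ‖∇W‖`, so the dissipation is at least `(κ/ρ²) W²`.
      refine tendsto_zero_of_deriv_le (a := S.κ / ρ ^ 2) (b := b * ‖y 0‖ * (M + 1)) (by positivity)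
        (by positivity) hα (fun t _ => S.W_nonneg _) (fun t ht => (hw t ht).1)
        fun t ht => (hw t ht).2.trans ?_
      have h1 : S.W (y t).1 ≤ ‖S.F (y t).1 0‖ * ρ := by
        refine (S.W_le_inner _).trans ((real_inner_le_norm _ _).trans ?_)
        gcongr
        exact (norm_fst_le (y t)).trans (hbd' t ht)
      have h2 : S.κ / ρ ^ 2 * S.W (y t).1 ^ 2 ≤ S.κ * ‖S.F (y t).1 0‖ ^ 2 := by
        calc _ ≤ S.κ / ρ ^ 2 * (‖S.F (y t).1 0‖ * ρ) ^ 2 := by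
              have := S.W_nonneg (y t).1
              gcongr
          _ = _ := by field_simp
      have h3 : b * ‖y 0‖ * Real.exp (-α * t) * (S.W (y t).1 + 1)
          ≤ b * ‖y 0‖ * Real.exp (-α * t) * (M + 1) := by
        gcongr
        exact hM' t ht
      linarith
    have hfst : Tendsto (fun t => (y t).1) atTop (𝓝 0) := by
      rw [Metric.tendsto_nhds]
      intro ε hε
      obtain ⟨m, hm, hco⟩ := exists_mul_norm_le_of_strictConvexOn S.W_convex S.W_continuous
        S.W_zero S.W_nonneg hε
      filter_upwards [hWlim.eventually_lt_const (mul_pos hm hε)] with t ht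
      rw [dist_zero_right]
      by_contra! hge
      have h1 := hco _ hge
      have h3 : m * ε ≤ m * ‖(y t).1‖ := by gcongr
      linarith
    have hsnd : Tendsto (fun t => (y t).2) atTop (𝓝 0) := by
      have hexp : Tendsto (fun t => A * ‖y 0‖ * Real.exp (-β * t)) atTop (𝓝 0) := by
        have : Tendsto (fun t => Real.exp (-β * t)) atTop (𝓝 0) := by
          refine (Real.tendsto_exp_neg_atTop_nhds_zero.comp
            (tendsto_id.const_mul_atTop hβ)).congr ?_
          intro t
          simp
        simpa using this.const_mul (A * ‖y 0‖)
      refine squeeze_zero_norm' ?_ hexp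
      filter_upwards [eventually_ge_atTop 0] with t ht
      exact hdecay (t + 1) y (hy.mono Ico_subset_Ici_self) t ⟨ht, by linarith⟩
    exact hfst.prodMk_nhds hsnd

end Cascade

/-! ### Affine changes of coordinates -/

section Transport

variable {V V' : Type*} [NormedAddCommGroup V] [NormedSpace ℝ V] [NormedAddCommGroup V']
  [NormedSpace ℝ V'] {f : V → V} {g : V' → V'} {p : V}

theorem IsSolutionOn.map (Ψ : V ≃L[ℝ] V') (hfg : ∀ v, g (Ψ (v - p)) = Ψ (f v)) {I : Set ℝ}
    {x : ℝ → V} (hx : IsSolutionOn f I x) : IsSolutionOn g I fun t => Ψ (x t - p) := fun t ht => by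
  rw [hfg]
  exact Ψ.hasFDerivAt.comp_hasDerivWithinAt t ((hx t ht).sub_const p)

theorem IsSolutionOn.map_symm (Ψ : V ≃L[ℝ] V') (hfg : ∀ v, g (Ψ (v - p)) = Ψ (f v)) {I : Set ℝ}
    {y : ℝ → V'} (hy : IsSolutionOn g I y) :
    IsSolutionOn f I fun t => Ψ.symm (y t) + p := fun t ht => by
  have h : f (Ψ.symm (y t) + p) = Ψ.symm (g (y t)) := by
    rw [ContinuousLinearEquiv.eq_symm_apply, ← hfg]
    simp
  rw [h]
  exact (Ψ.symm.hasFDerivAt.comp_hasDerivWithinAt t (hy t ht)).add_const p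

/-- Solutions are carried in both directions, because they need not be unique: existence and
extension use the inverse map, stability and attraction the direct one. -/
theorem IsGAS.of_equiv (Ψ : V ≃L[ℝ] V') (hfg : ∀ v, g (Ψ (v - p)) = Ψ (f v)) (hg : IsGAS g 0) :
    IsGAS f p where
  equilibrium := by
    have := hfg p
    rw [sub_self, map_zero, hg.equilibrium] at this
    exact (map_eq_zero_iff Ψ Ψ.injective).1 this.symm
  complete := by
    refine ⟨fun x₀ => ?_, fun T x hT hx => ?_⟩
    · obtain ⟨y, hy0, hy⟩ := hg.complete.1 (Ψ (x₀ - p))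
      exact ⟨_, by simp [hy0], hy.map_symm Ψ hfg⟩
    · obtain ⟨y, hy, he⟩ := hg.complete.2 T _ hT (hx.map Ψ hfg)
      refine ⟨_, hy.map_symm Ψ hfg, fun t ht => ?_⟩
      simp [← he ht]
  stable := by
    intro ε hε
    obtain ⟨ε', hε', h1⟩ := Metric.continuous_iff.1 Ψ.symm.continuous 0 ε hε
    obtain ⟨δ', hδ', h2⟩ := hg.stable ε' hε'
    obtain ⟨δ, hδ, h3⟩ := Metric.continuous_iff.1 Ψ.continuous 0 δ' hδ'
    refine ⟨δ, hδ, fun x hx h0 t ht => ?_⟩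
    have h4 := h2 _ (hx.map Ψ hfg) (by
      simpa using h3 (x 0 - p) (by simpa [dist_eq_norm] using h0)) t ht
    simpa [dist_eq_norm] using h1 _ h4
  attractive := by
    intro x hx
    have h := (Ψ.symm.continuous.tendsto 0).comp (hg.attractive _ (hx.map Ψ hfg))
    have h' := h.add_const p
    simpa [Function.comp_def] using h'

end Transport

/-! ### Coordinates of the circuit -/

variable {n : ℕ}

theorem stack_castSucc (v : Fin n → ℝ) (a : ℝ) (k : Fin n) : stack v a k.castSucc = v k := by
  simp [stack]

theorem stack_last (v : Fin n → ℝ) (a : ℝ) : stack v a (Fin.last n) = a := by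
  simp [stack]

theorem stack_inj {v w : Fin n → ℝ} {a b : ℝ} : stack v a = stack w b ↔ v = w ∧ a = b := by
  simp [stack, Fin.snoc_inj]

namespace Circuit

variable (P : Circuit n)

theorem Leq_pos (hL : ∀ k, 0 < P.L k) (k : Fin (n + 1)) : 0 < P.Leq k :=
  inv_pos.2 (Finset.sum_pos (fun j _ => one_div_pos.2 (hL j)) ⟨k, by simp⟩)

theorem Leq_mul_sum (hL : ∀ k, 0 < P.L k) (k : Fin (n + 1)) :
    P.Leq k * ∑ j ∈ Finset.Iic k, 1 / P.L j = 1 :=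
  inv_mul_cancel₀ (inv_pos.1 (P.Leq_pos hL k)).ne'

theorem gammaT_mulVec (v : Fin (n + 1) → ℝ) (k : Fin n) :
    (P.GammaT *ᵥ v) k
      = P.Leq k.castSucc * ∑ j ∈ Finset.Iic k.castSucc, v j / P.L j - v k.succ := by
  rw [GammaT, Matrix.sub_mulVec, Pi.sub_apply]
  congr 1
  · simp only [Matrix.mulVec, dotProduct, G, Matrix.of_apply, ite_mul, zero_mul]
    rw [← Finset.sum_filter, Finset.mul_sum]
    refine Finset.sum_congr (by ext; simp) fun j _ => ?_
    ring
  · simp [Matrix.mulVec, dotProduct]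

theorem M_mulVec (v : Fin (n + 1) → ℝ) :
    P.M *ᵥ v = stack (P.GammaT *ᵥ v) (P.LeqTotal * ∑ k, v k / P.L k) := by
  ext i
  refine Fin.lastCases ?_ (fun k => ?_) i
  · rw [stack_last, Finset.mul_sum]
    simp only [Matrix.mulVec, dotProduct, M, Matrix.of_apply, Fin.snoc_last, totalRow]
    exact Finset.sum_congr rfl fun j _ => by ring
  · rw [stack_castSucc]
    simp [Matrix.mulVec, M]

theorem M_mulVec_state (x : State n) :
    P.M *ᵥ WithLp.ofLp x.1 = stack (WithLp.ofLp (P.fluxDist x)) (P.phiT x) :=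
  P.M_mulVec _

theorem LeqTotal_mul_sum (hL : ∀ k, 0 < P.L k) : P.LeqTotal * ∑ j, 1 / P.L j = 1 := by
  have h := P.Leq_mul_sum hL (Fin.last n)
  rwa [show Finset.Iic (Fin.last n) = Finset.univ by ext j; simp [Fin.le_last]] at h

/-- The decoupling identity: a voltage common to all coils does not move the flux distribution. -/
theorem M_mulVec_one (hL : ∀ k, 0 < P.L k) : P.M *ᵥ (fun _ => 1) = stack 0 1 := by
  rw [M_mulVec, stack_inj]
  refine ⟨?_, P.LeqTotal_mul_sum hL⟩
  ext k
  rw [gammaT_mulVec, P.Leq_mul_sum hL]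
  simp

/-- A vector in the kernel of `Γᵀ` has each entry equal to a weighted mean of the preceding ones,
hence is constant; the last row, a weighted mean of all entries, makes the constant zero. -/
theorem M_mulVec_injective (hL : ∀ k, 0 < P.L k) : Function.Injective P.M.mulVec := by
  have hinj : Function.Injective P.M.mulVecLin := by
    refine (injective_iff_map_eq_zero _).2 fun v hv => ?_
    have h0 : P.M *ᵥ v = stack 0 0 := by
      refine Eq.trans hv ?_
      ext i
      refine Fin.lastCases ?_ (fun k => ?_) i
      · rw [stack_last]; rfl
      · rw [stack_castSucc]; rfl
    rw [M_mulVec, stack_inj] at h0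
    obtain ⟨hΓ, hT⟩ := h0
    have hconst : ∀ (i : ℕ) (h : i < n + 1), v ⟨i, h⟩ = v 0 := by
      intro i
      induction i using Nat.strong_induction_on with
      | _ i ih =>
        intro h
        rcases i with _ | i
        · rfl
        · have h1 := congr_fun hΓ ⟨i, by omega⟩
          rw [gammaT_mulVec] at h1
          have h2 : ∑ j ∈ Finset.Iic (Fin.castSucc ⟨i, by omega⟩), v j / P.L j
              = v 0 * ∑ j ∈ Finset.Iic (Fin.castSucc ⟨i, by omega⟩), 1 / P.L j := by
            rw [Finset.mul_sum]
            refine Finset.sum_congr rfl fun j hj => ?_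
            have hj' : (j : ℕ) ≤ i := by simpa [Fin.le_def] using hj
            rw [show v j = v 0 from ih j (by omega) j.2]
            ring
          rw [h2, mul_left_comm, P.Leq_mul_sum hL, mul_one, Pi.zero_apply, sub_eq_zero] at h1
          exact h1.symm
    have hv' : v = fun _ => v 0 := by
      ext k
      exact hconst k k.2
    have h3 : P.LeqTotal * ∑ k, v k / P.L k = v 0 * (P.LeqTotal * ∑ k, 1 / P.L k) := by
      rw [mul_left_comm, Finset.mul_sum (a := v 0)]
      congr 1
      refine Finset.sum_congr rfl fun j _ => ?_
      rw [hv']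
      ring
    rw [h3, P.LeqTotal_mul_sum hL, mul_one] at hT
    rw [hv', hT]
    rfl
  exact hinj

theorem M_isUnit_det (hL : ∀ k, 0 < P.L k) : IsUnit P.M.det :=
  (Matrix.isUnit_iff_isUnit_det _).1 (Matrix.mulVec_injective_iff_isUnit.1 (P.M_mulVec_injective hL))

theorem M_mulVec_inv_mulVec (hL : ∀ k, 0 < P.L k) (v : Fin (n + 1) → ℝ) :
    P.M *ᵥ (P.M⁻¹ *ᵥ v) = v := by
  rw [Matrix.mulVec_mulVec, Matrix.mul_nonsing_inv _ (P.M_isUnit_det hL), Matrix.one_mulVec]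

theorem fluxDist_phiT_Phi (hL : ∀ k, 0 < P.L k) (c : EuclideanSpace ℝ (Fin n)) (φ Q : ℝ) :
    P.fluxDist (P.Phi c φ Q) = c ∧ P.phiT (P.Phi c φ Q) = φ := by
  have h := P.M_mulVec_state (P.Phi c φ Q)
  have h1 : WithLp.ofLp (P.Phi c φ Q).1 = P.M⁻¹ *ᵥ stack (WithLp.ofLp c) φ := rfl
  rw [h1, P.M_mulVec_inv_mulVec hL, stack_inj] at h
  exact ⟨(WithLp.ofLp_injective 2 h.1).symm, h.2.symm⟩

theorem Phi_fluxDist_phiT (hL : ∀ k, 0 < P.L k) (x : State n) :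
    P.Phi (P.fluxDist x) (P.phiT x) x.2 = x := by
  refine Prod.ext (WithLp.ofLp_injective 2 ?_) rfl
  refine P.M_mulVec_injective hL ?_
  change P.M *ᵥ (P.M⁻¹ *ᵥ _) = P.M *ᵥ _
  rw [P.M_mulVec_inv_mulVec hL, M_mulVec_state]

/-- The closed-loop flux dynamics in the coordinates `(𝒞, φ_T)`. -/
theorem fluxDist_phiT_closedLoop (hL : ∀ k, 0 < P.L k) (hE : ∀ k, P.E k ≠ 0) (R Qr : ℝ)
    (J : State n → ℝ) (Et : Fin n → ℝ) (hEt : ∀ k, Et k ≠ 0) {Eeq : ℝ} (hEeq : Eeq ≠ 0)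
    (K : Matrix (Fin n) (Fin n) ℝ) (kd ki : ℝ) (s : State n × ℝ) :
    P.fluxDist (P.closedLoop R (P.controller Qr J Et Eeq K kd ki) s).1
      = -Matrix.toEuclideanCLM (𝕜 := ℝ) K (P.gradJz Qr J (P.fluxDist s.1) (P.phiT s.1)) ∧
    P.phiT (P.closedLoop R (P.controller Qr J Et Eeq K kd ki) s).1
      = -(s.1.2 / P.C) - (kd * (P.phiT s.1 / P.LeqTotal) + kd * s.2
        + P.LeqTotal * ki * ((s.1.2 - Qr) / P.C)) := by
  set x' := (P.closedLoop R (P.controller Qr J Et Eeq K kd ki) s).1 with hx'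
  set w := stack (P.lam Qr J Et K s.1) (P.mu Qr Eeq kd ki s.1 s.2) with hw
  have hEd : (fun k => P.E k * (P.U Et Eeq *ᵥ w) k)
      = P.M⁻¹ *ᵥ (Matrix.diagonal (stack Et Eeq) *ᵥ w) := by
    have hEu : IsUnit (Matrix.diagonal P.E).det := by
      rw [Matrix.det_diagonal]
      exact (Finset.prod_ne_zero_iff.2 fun k _ => hE k).isUnit
    have h1 : (fun k => P.E k * (P.U Et Eeq *ᵥ w) k)
        = Matrix.diagonal P.E *ᵥ (P.U Et Eeq *ᵥ w) := by
      ext k; rw [Matrix.mulVec_diagonal]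
    rw [h1, U, Matrix.mulVec_mulVec, Matrix.mulVec_mulVec, ← Matrix.mul_assoc, ← Matrix.mul_assoc,
      Matrix.mul_nonsing_inv _ hEu, Matrix.one_mul]
  have hx1 : WithLp.ofLp x'.1 = (-(s.1.2 / P.C)) • (fun _ => (1 : ℝ))
      + fun k => P.E k * (P.U Et Eeq *ᵥ w) k := by
    ext k
    simp [hx', closedLoop, plant, controller, hw]
  have hM := P.M_mulVec_state x'
  rw [hx1, hEd, Matrix.mulVec_add, P.M_mulVec_inv_mulVec hL, Matrix.mulVec_smul,
    P.M_mulVec_one hL] at hM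
  constructor
  · refine WithLp.ofLp_injective 2 ?_
    ext k
    have h := congr_fun hM k.castSucc
    rw [stack_castSucc, Pi.add_apply, Pi.smul_apply, stack_castSucc, Matrix.mulVec_diagonal, hw,
      stack_castSucc, stack_castSucc] at h
    rw [← h]
    have hEtu : Matrix.diagonal Et *ᵥ ((Matrix.diagonal Et)⁻¹ *ᵥ
        (K *ᵥ WithLp.ofLp (P.gradJz Qr J (P.fluxDist s.1) (P.phiT s.1))))
        = K *ᵥ WithLp.ofLp (P.gradJz Qr J (P.fluxDist s.1) (P.phiT s.1)) := by
      rw [Matrix.mulVec_mulVec, Matrix.mul_nonsing_inv, Matrix.one_mulVec]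
      rw [Matrix.det_diagonal]
      exact (Finset.prod_ne_zero_iff.2 fun k _ => hEt k).isUnit
    have h2 := congr_fun hEtu k
    rw [Matrix.mulVec_diagonal] at h2
    rw [lam, Pi.neg_apply, mul_neg, h2]
    simp
  · have h := congr_fun hM (Fin.last n)
    rw [stack_last, Pi.add_apply, Pi.smul_apply, stack_last, Matrix.mulVec_diagonal, hw,
      stack_last, stack_last] at h
    rw [← h, mu, smul_eq_mul]
    field_simp
    ring

/-- The (linear part of the) change to the coordinates `(𝒞, i + ξ, v, ξ)`. -/
noncomputable def coordLinearMap : State n × ℝ →ₗ[ℝ] EuclideanSpace ℝ (Fin n) × ℝ × ℝ × ℝ where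
  toFun s := (P.fluxDist s.1, P.phiT s.1 / P.LeqTotal + s.2, s.1.2 / P.C, s.2)
  map_add' s t := by
    refine Prod.ext ?_ (Prod.ext ?_ (Prod.ext ?_ rfl))
    · simp [fluxDist, Matrix.mulVec_add]
    · simp only [phiT, Prod.fst_add, Prod.snd_add, PiLp.add_apply, add_div, Finset.sum_add_distrib,
        mul_add]
      ring
    · simp [add_div]
  map_smul' a s := by
    refine Prod.ext ?_ (Prod.ext ?_ (Prod.ext ?_ rfl))
    · simp [fluxDist, Matrix.mulVec_smul]
    · simp only [phiT, Prod.smul_fst, Prod.smul_snd, PiLp.smul_apply, smul_eq_mul, mul_div_assoc,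
        ← Finset.mul_sum, RingHom.id_apply]
      ring
    · simp [mul_div_assoc]

theorem coordLinearMap_injective (hL : ∀ k, 0 < P.L k) (hC : 0 < P.C) :
    Function.Injective P.coordLinearMap := by
  intro s t h
  simp only [coordLinearMap, LinearMap.coe_mk, AddHom.coe_mk, Prod.mk.injEq] at h
  obtain ⟨h1, h2, h3, h4⟩ := h
  have hT := P.Leq_pos hL (Fin.last n)
  rw [div_left_inj' hC.ne'] at h3
  rw [h4, add_left_inj, div_left_inj' (show P.LeqTotal ≠ 0 from hT.ne')] at h2
  refine Prod.ext ?_ h4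
  rw [← P.Phi_fluxDist_phiT hL s.1, h1, h2, h3, P.Phi_fluxDist_phiT hL]

/-- The change to the coordinates `(𝒞, i + ξ, v, ξ)` as an equivalence. -/
noncomputable def coordEquiv (hL : ∀ k, 0 < P.L k) (hC : 0 < P.C) :
    (State n × ℝ) ≃L[ℝ] EuclideanSpace ℝ (Fin n) × ℝ × ℝ × ℝ :=
  (LinearEquiv.ofInjectiveOfFinrankEq P.coordLinearMap (P.coordLinearMap_injective hL hC)
    (by simp [Module.finrank_prod])).toContinuousLinearEquiv

theorem coordEquiv_apply (hL : ∀ k, 0 < P.L k) (hC : 0 < P.C) (s : State n × ℝ) :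
    P.coordEquiv hL hC s = (P.fluxDist s.1, P.phiT s.1 / P.LeqTotal + s.2, s.1.2 / P.C, s.2) :=
  rfl

end Circuit

/-! ### The cost in the new coordinates -/

namespace CostAssumption

variable {n : ℕ} {P : Circuit n} {Qr : ℝ} {J : State n → ℝ}

theorem hasFDerivAt_partial (hJ : CostAssumption P Qr J) (c : EuclideanSpace ℝ (Fin n)) (φ : ℝ) :
    HasFDerivAt (fun c' => P.Jz Qr J c' φ)
      ((fderiv ℝ (fun p : EuclideanSpace ℝ (Fin n) × ℝ => P.Jz Qr J p.1 p.2) (c, φ)).comp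
        (ContinuousLinearMap.inl ℝ _ ℝ)) c := by
  have h1 : HasFDerivAt (fun c' : EuclideanSpace ℝ (Fin n) => (c', φ))
      (ContinuousLinearMap.inl ℝ _ ℝ) c := hasFDerivAt_prodMk_left c φ
  exact (((hJ.smooth.differentiable one_ne_zero) (c, φ)).hasFDerivAt).comp c h1

theorem hasGradientAt (hJ : CostAssumption P Qr J) (c : EuclideanSpace ℝ (Fin n)) (φ : ℝ) :
    HasGradientAt (fun c' => P.Jz Qr J c' φ) (P.gradJz Qr J c φ) c :=
  (hJ.hasFDerivAt_partial c φ).differentiableAt.hasGradientAt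

theorem continuous_gradJz (hJ : CostAssumption P Qr J) :
    Continuous fun p : EuclideanSpace ℝ (Fin n) × ℝ => P.gradJz Qr J p.1 p.2 := by
  have h : ∀ p : EuclideanSpace ℝ (Fin n) × ℝ, P.gradJz Qr J p.1 p.2
      = (InnerProductSpace.toDual ℝ (EuclideanSpace ℝ (Fin n))).symm
        ((fderiv ℝ (fun p : EuclideanSpace ℝ (Fin n) × ℝ => P.Jz Qr J p.1 p.2) p).comp
          (ContinuousLinearMap.inl ℝ _ ℝ)) := fun p => by
    rw [Circuit.gradJz, gradient, (hJ.hasFDerivAt_partial p.1 p.2).fderiv]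
  simp only [h]
  exact (LinearIsometryEquiv.continuous _).comp
    ((hJ.smooth.continuous_fderiv one_ne_zero).clm_comp continuous_const)

theorem Cstar_le (hJ : CostAssumption P Qr J) {φ : ℝ} (hφ : 0 < φ) (c : EuclideanSpace ℝ (Fin n)) :
    P.Jz Qr J (P.Cstar Qr J φ) φ ≤ P.Jz Qr J c φ :=
  Classical.epsilon_spec (hJ.hasMin φ hφ) c

theorem Cstar_lt (hJ : CostAssumption P Qr J) {φ : ℝ} (hφ : 0 < φ)
    {c : EuclideanSpace ℝ (Fin n)} (hc : c ≠ P.Cstar Qr J φ) :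
    P.Jz Qr J (P.Cstar Qr J φ) φ < P.Jz Qr J c φ := by
  refine lt_of_le_of_ne (hJ.Cstar_le hφ c) fun h => hc ?_
  refine (hJ.convex φ hφ).eq_of_isMinOn ?_ ?_ (mem_univ _) (mem_univ _)
  · exact fun c' _ => by simpa only [mem_ofPred_eq, ← h] using hJ.Cstar_le hφ c'
  · exact fun c' _ => hJ.Cstar_le hφ c'

theorem hasGradientAt_W (hJ : CostAssumption P Qr J) (R : ℝ) (c : EuclideanSpace ℝ (Fin n)) :
    HasGradientAt (P.W R Qr J)
      (P.gradJz Qr J (c + P.Cstar Qr J (P.phiStar R Qr)) (P.phiStar R Qr)) c := by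
  have h := (hJ.hasGradientAt (c + P.Cstar Qr J (P.phiStar R Qr)) (P.phiStar R Qr)).hasFDerivAt
  rw [hasGradientAt_iff_hasFDerivAt]
  exact ((hasFDerivAt_comp_add_right _).2 h).sub_const _

theorem strictConvexOn_W (hJ : CostAssumption P Qr J) {R : ℝ} (hφ : 0 < P.phiStar R Qr) :
    StrictConvexOn ℝ univ (P.W R Qr J) := by
  refine ⟨convex_univ, fun x _ y _ hxy a b ha hb hab => ?_⟩
  have hconv := (hJ.convex _ hφ).2
  set c₀ := P.Cstar Qr J (P.phiStar R Qr) with hc₀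
  have h := hconv (mem_univ (x + c₀)) (mem_univ (y + c₀)) (by simpa using hxy) ha hb hab
  have e : a • (x + c₀) + b • (y + c₀) = a • x + b • y + c₀ := by
    calc _ = a • x + b • y + (a + b) • c₀ := by module
      _ = _ := by rw [hab, one_smul]
  rw [e] at h
  simp only [Circuit.W, ← hc₀, smul_eq_mul] at h ⊢
  have : P.Jz Qr J c₀ (P.phiStar R Qr) = (a + b) * P.Jz Qr J c₀ (P.phiStar R Qr) := by
    rw [hab, one_mul]
  linarith

end CostAssumption

/-- Compactness of the unit sphere and homogeneity. The sphere is empty when `n = 0`, a case that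
`exists_forall_le'` allows. -/
theorem exists_mul_sq_le_inner {n : ℕ} {K : Matrix (Fin n) (Fin n) ℝ} (hK : K.PosDef) :
    ∃ κ > 0, ∀ x : EuclideanSpace ℝ (Fin n),
      κ * ‖x‖ ^ 2 ≤ inner ℝ x (Matrix.toEuclideanCLM (𝕜 := ℝ) K x) := by
  set T := Matrix.toEuclideanCLM (𝕜 := ℝ) K with hT
  have hpos : ∀ x : EuclideanSpace ℝ (Fin n), x ≠ 0 → 0 < inner ℝ x (T x) := by
    intro x hx
    have h := hK.dotProduct_mulVec_pos (x := WithLp.ofLp x) (by simpa using hx)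
    rw [EuclideanSpace.inner_eq_star_dotProduct, hT, Matrix.ofLp_toEuclideanCLM, dotProduct_comm]
    exact h
  obtain ⟨κ, hκ, hle⟩ := (isCompact_sphere (0 : EuclideanSpace ℝ (Fin n)) 1).exists_forall_le'
    (f := fun x => inner ℝ x (T x)) (by fun_prop) (a := 0) fun x hx => hpos x (by
      rintro rfl
      simp at hx)
  refine ⟨κ, hκ, fun x => ?_⟩
  rcases eq_or_ne x 0 with rfl | hx
  · simp
  have hn : 0 < ‖x‖ := norm_pos_iff.2 hx
  have h := hle (‖x‖⁻¹ • x) (by simp [norm_smul, hn.ne'])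
  simp only [map_smul, real_inner_smul_left, real_inner_smul_right] at h
  calc κ * ‖x‖ ^ 2 ≤ (‖x‖⁻¹ * (‖x‖⁻¹ * inner ℝ x (T x))) * ‖x‖ ^ 2 := by gcongr
    _ = _ := by field_simp

namespace Circuit

variable {n : ℕ} (P : Circuit n)

/-- As `E k ≠ 0`, a suitable duty cycle balances every flux equation; only the charge equation
constrains the state, and it fixes `φ_T`. -/
theorem mem_admissible_iff (hL : ∀ k, 0 < P.L k) (hE : ∀ k, P.E k ≠ 0) (R Qr : ℝ) (x : State n) :
    x ∈ P.admissible R Qr ↔ x.2 = Qr ∧ P.phiT x = P.phiStar R Qr := by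
  have hT : P.LeqTotal ≠ 0 := (P.Leq_pos hL (Fin.last n)).ne'
  refine and_congr_right fun hQ => ?_
  rw [phiT, phiStar, mul_div_assoc, mul_right_inj' hT, ← hQ]
  constructor
  · rintro ⟨d, hd⟩
    have := congr_arg Prod.snd hd
    simpa [plant, sub_eq_zero] using this
  · intro h
    refine ⟨fun k => x.2 / P.C / P.E k, Prod.ext ?_ ?_⟩
    · ext k
      have := hE k
      simp [plant, mul_div_cancel₀ _ this]
    · simpa [plant, sub_eq_zero] using h

end Circuit

end Buck

/-! ### Conjugation of the closed loop with the cascade -/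

theorem theorem2 {n : ℕ} (P : Buck.Circuit n)
    (hL : ∀ k, 0 < P.L k) (hE : ∀ k, P.E k ≠ 0) (hC : 0 < P.C)
    (Qr : ℝ) (hQr : 0 < Qr)
    (J : Buck.State n → ℝ) (hJ : Buck.CostAssumption P Qr J)
    (Et : Fin n → ℝ) (hEt : ∀ k, 0 < Et k) (Eeq : ℝ) (hEeq : 0 < Eeq)
    (K : Matrix (Fin n) (Fin n) ℝ) (hK : K.PosDef)
    (kd ki : ℝ) (hkd : 0 < kd) (hki : 0 < ki) :
    ∀ R : ℝ, 0 < R → Buck.GrowthF1 P R Qr J → Buck.GrowthF2 P R Qr J →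
      Buck.SolvesProblem P R Qr J (P.controller Qr J Et Eeq K kd ki) := by
  intro R hR h1 h2
  have hT : 0 < P.LeqTotal := P.Leq_pos hL (Fin.last n)
  have hφ : 0 < P.phiStar R Qr := by unfold Buck.Circuit.phiStar; positivity
  set φs := P.phiStar R Qr with hφs
  set cs := P.Cstar Qr J φs with hcs
  -- Solves `-Q_r/C - kd (φ_T⋆/L + ξ) = 0`. It depends on `R`, but the controller does not: the
  -- integrator finds it.
  set ξs : ℝ := -(Qr / (R * P.C)) - Qr / P.C / kd with hξs
  obtain ⟨hPc, hPφ⟩ := P.fluxDist_phiT_Phi hL cs φs Qr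
  obtain ⟨κ, hκ, hKκ⟩ := Buck.exists_mul_sq_le_inner hK
  let S : Buck.Cascade (EuclideanSpace ℝ (Fin n)) :=
    { L := P.LeqTotal
      C := P.C
      R := R
      kd := kd
      ki := ki
      K := Matrix.toEuclideanCLM (𝕜 := ℝ) K
      κ := κ
      F := fun c φ => P.gradJz Qr J (c + cs) (φ + φs)
      W := P.W R Qr J
      L_pos := hT
      C_pos := hC
      R_pos := hR
      kd_pos := hkd
      ki_pos := hki
      κ_pos := hκ
      K_ge := hKκ
      F_cont := hJ.continuous_gradJz.comp
        (f := fun p : EuclideanSpace ℝ (Fin n) × ℝ => (p.1 + cs, p.2 + φs)) (by fun_prop)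
      W_grad := fun c => by simpa only [zero_add] using hJ.hasGradientAt_W R c
      W_zero := by simp [Buck.Circuit.W]
      W_nonneg := fun c => sub_nonneg.2 (hJ.Cstar_le hφ _)
      W_convex := hJ.strictConvexOn_W hφ
      growth := by
        simp only [zero_add]
        exact h1
      growthW := by
        obtain ⟨c₀, hc₀, k, hk, h⟩ := h2
        refine ⟨c₀, hc₀, k, hk, fun c hc => ?_⟩
        have := h c hc
        rw [(hJ.hasGradientAt_W R c).gradient] at this
        simpa only [zero_add] using this }
  set x := P.Phi cs φs Qr with hx
  have hconj : ∀ s, S.field (P.coordEquiv hL hC (s - (x, ξs)))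
      = P.coordEquiv hL hC (P.closedLoop R (P.controller Qr J Et Eeq K kd ki) s) := by
    intro s
    obtain ⟨e1, e2⟩ := P.fluxDist_phiT_closedLoop hL hE R Qr J Et (fun k => (hEt k).ne')
      hEeq.ne' K kd ki s
    have hsum : ∑ k, s.1.1 k / P.L k = P.phiT s.1 / P.LeqTotal := by
      rw [Buck.Circuit.phiT, mul_div_cancel_left₀ _ hT.ne']
    have hφL : φs / P.LeqTotal = Qr / (R * P.C) := by
      rw [hφs, Buck.Circuit.phiStar]; field_simp
    rw [map_sub]
    simp only [Buck.Circuit.coordEquiv_apply, e1, e2, hPc, hPφ, Prod.mk_sub_mk, hφL]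
    have ex2 : x.2 = Qr := rfl
    refine Prod.ext ?_ (Prod.ext ?_ (Prod.ext ?_ ?_))
    · have hφe : P.LeqTotal * (P.phiT s.1 / P.LeqTotal + s.2 - (Qr / (R * P.C) + ξs) - (s.2 - ξs))
          + φs = P.phiT s.1 := by
        have : φs = P.LeqTotal * (Qr / (R * P.C)) := by rw [← hφL]; field_simp
        rw [this]
        field_simp
        ring
      simp only [Buck.Cascade.field, S, sub_add_cancel, hφe]
    · simp only [Buck.Cascade.field, S, Buck.Circuit.closedLoop, Buck.Circuit.controller, ex2, hξs]
      field_simp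
      ring
    · simp only [Buck.Cascade.field, S, Buck.Circuit.closedLoop, Buck.Circuit.plant, ex2, hsum]
      field_simp
      ring
    · simp only [Buck.Cascade.field, S, Buck.Circuit.closedLoop, Buck.Circuit.controller, ex2]
      ring
  refine ⟨x, ξs, ⟨(P.mem_admissible_iff hL hE R Qr x).2 ⟨rfl, hPφ⟩, fun y hy hyx => ?_⟩,
    fun s => ?_, S.isGAS.of_equiv (P.coordEquiv hL hC) hconj⟩
  · obtain ⟨hyQ, hyφ⟩ := (P.mem_admissible_iff hL hE R Qr y).1 hy
    have hy' := P.Phi_fluxDist_phiT hL y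
    rw [hyQ, hyφ] at hy'
    have hne : P.fluxDist y ≠ cs := fun h => hyx (by rw [← hy', h])
    have := hJ.Cstar_lt hφ hne
    rwa [Buck.Circuit.Jz, Buck.Circuit.Jz, hy'] at this
  · rw [← map_eq_zero_iff (P.coordEquiv hL hC) (P.coordEquiv hL hC).injective, ← hconj,
      S.field_eq_zero_iff, map_eq_zero_iff _ (P.coordEquiv hL hC).injective, sub_eq_zero]
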